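/- Let the task time $T>0$ and the failure times $U_1,U_2,\dots>0$ be random variables such that $T$ has density $f$ on $(0,\infty)$, the $U_i$ are i.i.d. with density $g$ on $(0,\infty)$, and the sequence $(U_i)$ is independent of $T$. Let $N=\inf\{n\ge 0: U_{n+1}>T\}$, let $X=T+\sum_{i=1}^{N}U_i$ be the total time under the RESTART policy, and let $\overline H(x)=\mathbb P(X>x)$. Here a function $L$ is called slowly varying (at $\infty$) if it is measurable on $(0,\infty)$, bounded on compact subsets of $(0,\infty)$, eventually positive, and satisfies $L(cx)/L(x)\to 1$ as $x\to\infty$ for every $c>0$. Suppose that, for all $t>0$, $$f(t)=e^{-\lambda_F t^{\eta}}\,t^{\alpha_F}L_F(t),\qquad g(t)=e^{-\lambda_G t^{\eta}}\,t^{\alpha_G}L_G(t),$$ where $\lambda_F,\lambda_G>0$, $\eta>0$ (the same for $f$ and $g$), $\alpha_F,\alpha_G\in\mathbb R$, and $L_F,L_G$ are slowly varying. Then $0<\mathbb E U_1<\infty$, and with $\mu=1/\mathbb E U_1$, $\alpha_H=\lambda_F/\lambda_G$ and $$\omega=\frac{\alpha_F}{\eta}+\frac{\alpha_H(\eta-\alpha_G-1)}{\eta}+\frac1\eta-1,$$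 there is a slowly varying function $L_H$ such that $\overline H(x)=L_H(x)/x^{\alpha_H}$ for all $x>0$ and, as $x\to\infty$, $$L_H(x)\ \sim\ \frac{\Gamma(\alpha_H)\,\lambda_G^{\alpha_H-1-\omega}\,\eta^{\alpha_H-1}}{\mu^{\alpha_H}}\;\log^{\omega}x\;\frac{L_F\bigl(\log^{1/\eta}x\bigr)}{L_G^{\alpha_H}\bigl(\log^{1/\eta}x\bigr)}.$$ -/

import Mathlib

open MeasureTheory ProbabilityTheory Filter Topology Asymptotics

/-- Slow variation at infinity of a function on `(0, ∞)` (the values at nonpositive reals play no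
role): `L` is measurable, bounded on compact subsets of `(0, ∞)`, eventually positive, and
`L (c x) / L x → 1` as `x → ∞` for every `c > 0`. -/
structure IsSlowlyVarying (L : ℝ → ℝ) : Prop where
  measurable_restrict : Measurable (fun x : Set.Ioi (0 : ℝ) => L x)
  bounded_on_compacts : ∀ K : Set ℝ, IsCompact K → K ⊆ Set.Ioi 0 → Bornology.IsBounded (L '' K)
  eventually_pos : ∀ᶠ x in atTop, 0 < L x
  tendsto_ratio : ∀ c : ℝ, 0 < c → Tendsto (fun x => L (c * x) / L x) atTop (𝓝 1)

/-- The random variable `Y` is concentrated on `(0, ∞)` with probability density `f` there. -/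
structure HasPositiveDensity {Ω : Type*} [MeasurableSpace Ω] (P : Measure Ω) (Y : Ω → ℝ)
    (f : ℝ → ℝ) : Prop where
  measurable_density : Measurable f
  nonneg_density : ∀ t : ℝ, 0 < t → 0 ≤ f t
  hasLaw : HasLaw Y ((volume.restrict (Set.Ioi 0)).withDensity (fun t => ENNReal.ofReal (f t))) P

/-- The RESTART model: the task time `T` has density `f`, the failure times `U 0, U 1, …` are
i.i.d. with density `g`, and the sequence of failure times is independent of `T`. -/
structure IsRestartModel {Ω : Type*} [MeasurableSpace Ω] (P : Measure Ω) (T : Ω → ℝ)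
    (U : ℕ → Ω → ℝ) (f g : ℝ → ℝ) : Prop where
  task_density : HasPositiveDensity P T f
  failure_density : ∀ i, HasPositiveDensity P (U i) g
  failure_indep : iIndepFun U P
  task_indep_failure : IndepFun T (fun ω i => U i ω) P

/-- The number of restarts: the first index `n` (counted from `0`) with `U n > T`. It is `0` when
there is no such index, which has probability zero as soon as `P (U 0 > t) > 0` for all `t`. -/
noncomputable def restartCount {Ω : Type*} (T : Ω → ℝ) (U : ℕ → Ω → ℝ) (ω : Ω) : ℕ :=
  sInf {n : ℕ | T ω < U n ω}

/-- The total time: the task time plus all the failure times before the first one that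
exceeds the task time. -/
noncomputable def totalTime {Ω : Type*} (T : Ω → ℝ) (U : ℕ → Ω → ℝ) (ω : Ω) : ℝ :=
  T ω + ∑ i ∈ Finset.range (restartCount T U ω), U i ω

/-- The tail `x ↦ P (X > x)` of the total time `X`. -/
noncomputable def totalTimeTail {Ω : Type*} [MeasurableSpace Ω] (P : Measure Ω) (T : Ω → ℝ)
    (U : ℕ → Ω → ℝ) (x : ℝ) : ℝ :=
  P.real {ω | x < totalTime T U ω}

/-- The density `f` on `(0, ∞)` has the form `exp (-lam * t ^ η) * t ^ α * L t` with `L` slowly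
varying at infinity. -/
structure IsWeibullTypeDensity (lam η α : ℝ) (L f : ℝ → ℝ) : Prop where
  slowlyVarying : IsSlowlyVarying L
  eq_form : ∀ t : ℝ, 0 < t → f t = Real.exp (-lam * t ^ η) * t ^ α * L t

/-- The exponent of the logarithm in the tail asymptotics, with `αH` in the role of the ratio of
the two rates. -/
noncomputable def logExponent (η αF αG αH : ℝ) : ℝ :=
  αF / η + αH * (η - αG - 1) / η + 1 / η - 1

/-! Given `T = t`, the number of restarts is geometric with success probability p(t) = P(U > t). For
large t the total time is therefore nearly exponential with rate μ p(t), and P(X > x) behaves like ∫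
f(t) exp(-μ x p(t)) dt. The mass of this integral sits where x p(t) has order one.

On the scale s = t^η, common to both laws, the densities become φ(s) = exp(-λ s + ψ(s)) for large s,
where ψ has vanishing increments over bounded intervals (`IsExpRegular`). Hence the tail of the
failure law is φ_G(s) / λ_G up to a factor tending to 1 (`tendsto_tail`). If x φ_G(a(x)) → λ_G, then
at s = a(x) + w the quantity x p tends to exp(-λ_G w), while φ_F(a(x) + w) / φ_F(a(x)) tends to
exp(-λ_F w). So P(X > x) / φ_F(a(x)) tends to ∫ exp(-λ_F w) exp(-μ exp(-λ_G w)) dw, a Gamma integral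
(`tendsto_integral_div`).

The exchange of limit and integral rests on two facts about a fixed task time. The law of large
numbers gives the exponential limit (`tendsto_totalTimeTail`). A Chernoff bound for truncated
failure times gives C exp(-c x p(t)) uniformly in t (`exists_totalTimeTail_le_exp`); with Potter
bounds this yields an integrable majorant.

Finally, a(x) can be written explicitly (`criticalScale`). Inserting it in φ_F produces x^(-α_H)
times exp(ψ_F - α_H ψ_G). Moving the arguments of ψ_F and ψ_G to log x costs only powers of λ_G, and
expanding ψ_F and ψ_G gives the stated form. -/

/-! ### Additive slow variation: uniform convergence and Potter bounds. -/

/-- `h` varies slowly in the additive sense: its increments over intervals of length at most `1`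
tend to `0` uniformly at infinity. -/
def IsSlowlyOscillating (h : ℝ → ℝ) : Prop :=
  ∀ ε : ℝ, 0 < ε → ∃ A : ℝ, ∀ s : ℝ, A ≤ s → ∀ u ∈ Set.Icc (0 : ℝ) 1, |h (s + u) - h s| ≤ ε

/-- The additive form of the uniform convergence theorem for slowly varying functions. -/
theorem isSlowlyOscillating_of_tendsto {h : ℝ → ℝ} (hm : Measurable h)
    (hlim : ∀ u : ℝ, Tendsto (fun y => h (y + u) - h y) atTop (𝓝 0)) :
    IsSlowlyOscillating h := by
  -- Truncation at 1 lets the constant 1 dominate, so the averages `I` tend to 0 with no a priori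
  -- bound on `h`.
  set m : ℝ → ℝ → ℝ := fun y u => min 1 |h (y + u) - h y| with hmdef
  have m0 : ∀ y u, 0 ≤ m y u := fun y u => le_min zero_le_one (abs_nonneg _)
  have m1 : ∀ y u, m y u ≤ 1 := fun y u => min_le_left _ _
  have mm : ∀ y, Measurable (m y) := fun y => by
    simp only [hmdef]; fun_prop
  have mi : ∀ y a b, IntervalIntegrable (m y) volume a b := fun y a b => by
    refine (intervalIntegrable_const (c := (1 : ℝ))).mono_fun (mm y).aestronglyMeasurable ?_
    refine Eventually.of_forall fun v => ?_
    simp [abs_of_nonneg (m0 y v), m1 y v]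
  set I : ℝ → ℝ := fun y => ∫ v in (0 : ℝ)..2, m y v with hI
  have hI0 : Tendsto I atTop (𝓝 0) := by
    have := intervalIntegral.tendsto_integral_filter_of_dominated_convergence
      (μ := volume) (a := (0 : ℝ)) (b := 2) (l := (atTop : Filter ℝ)) (F := m) (f := fun _ => (0 : ℝ))
      (fun _ => (1 : ℝ)) (Eventually.of_forall fun y => (mm y).aestronglyMeasurable)
      (Eventually.of_forall fun y => Eventually.of_forall fun v _ => by
        simp [abs_of_nonneg (m0 y v), m1 y v]) intervalIntegrable_const
      (Eventually.of_forall fun v _ => by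
        have h1 := ((hlim v).abs)
        have h2 : Tendsto (fun y => min (1 : ℝ) |h (y + v) - h y|) atTop (𝓝 (min 1 |0|)) :=
          tendsto_const_nhds.min h1
        simpa using h2)
    simpa using this
  -- Averaging the triangle inequality through the intermediate point `y + u + v` over v in [0, 1]
  -- makes the bound uniform in `u`.
  have key : ∀ y, ∀ u ∈ Set.Icc (0 : ℝ) 1, m y u ≤ I (y + u) + I y := by
    intro y u hu
    have e1 : m y u = ∫ v in (0 : ℝ)..1, m y u := by simp
    have hsh : IntervalIntegrable (fun v => m y (u + v)) volume 0 1 := by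
      refine (intervalIntegrable_const (c := (1 : ℝ))).mono_fun
        ((mm y).comp (measurable_const_add u)).aestronglyMeasurable ?_
      refine Eventually.of_forall fun v => ?_
      simp [abs_of_nonneg (m0 y (u + v)), m1 y (u + v)]
    have e2 : ∫ v in (0 : ℝ)..1, m y u ≤ ∫ v in (0 : ℝ)..1, (m (y + u) v + m y (u + v)) := by
      refine intervalIntegral.integral_mono_on zero_le_one intervalIntegrable_const
        ((mi _ _ _).add hsh) fun v _ => ?_
      simp only [hmdef]
      have tri : |h (y + u) - h y| ≤ |h (y + u + v) - h (y + u)| + |h (y + (u + v)) - h y| := by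
        rw [← add_assoc, abs_sub_comm (h (y + u + v)) (h (y + u))]
        exact abs_sub_le _ _ _
      rcases min_cases (1 : ℝ) |h (y + u + v) - h (y + u)| with ⟨a, a'⟩ | ⟨a, a'⟩ <;>
      rcases min_cases (1 : ℝ) |h (y + (u + v)) - h y| with ⟨b, b'⟩ | ⟨b, b'⟩ <;>
      rw [a, b]
      · linarith [min_le_left (1 : ℝ) |h (y + u) - h y|]
      · linarith [min_le_left (1 : ℝ) |h (y + u) - h y|, abs_nonneg (h (y + (u + v)) - h y)]
      · linarith [min_le_left (1 : ℝ) |h (y + u) - h y|, abs_nonneg (h (y + u + v) - h (y + u))]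
      · exact (min_le_right _ _).trans tri
    rw [intervalIntegral.integral_add (mi _ _ _) hsh,
      intervalIntegral.integral_comp_add_left (m y) u] at e2
    have e3 : ∫ v in (0 : ℝ)..1, m (y + u) v ≤ I (y + u) :=
      intervalIntegral.integral_mono_interval le_rfl zero_le_one one_le_two
        (Eventually.of_forall fun v => m0 _ v) (mi _ _ _)
    have e4 : ∫ v in (u + 0)..(u + 1), m y v ≤ I y :=
      intervalIntegral.integral_mono_interval (by linarith [hu.1]) (by linarith)
        (by linarith [hu.2]) (Eventually.of_forall fun v => m0 _ v) (mi _ _ _)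
    linarith
  intro ε hε
  -- The cap 1/2 keeps `m` below 1, so the truncation is inactive and `m` is the true increment.
  have hδ : 0 < min ε (1 / 2) / 2 := by positivity
  obtain ⟨A, hA⟩ := eventually_atTop.1 (hI0.eventually (ge_mem_nhds hδ))
  refine ⟨A, fun s hs u hu => ?_⟩
  have k1 := key s u hu
  have k2 := hA s hs
  have k3 := hA (s + u) (by linarith [hu.1])
  have k4 : m s u ≤ min ε (1 / 2) := by linarith
  simp only [hmdef] at k4
  rcases min_le_iff.1 (k4.trans (min_le_right _ _)) with h' | h'
  · norm_num at h'
  · rw [min_eq_right (by linarith)] at k4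
    exact k4.trans (min_le_left _ _)

namespace IsSlowlyOscillating

variable {h : ℝ → ℝ}

/-- Chaining unit steps costs `ε` each; the extra 1 pays for the last incomplete step. -/
theorem potter (hh : IsSlowlyOscillating h) {ε : ℝ} (hε : 0 < ε) :
    ∃ A : ℝ, ∀ s s' : ℝ, A ≤ s → A ≤ s' → |h s' - h s| ≤ ε * (|s' - s| + 1) := by
  obtain ⟨A, hA⟩ := hh ε hε
  have step : ∀ (n : ℕ) (s : ℝ), A ≤ s → |h (s + n) - h s| ≤ ε * n := by
    intro n s hs
    induction n with
    | zero => simp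
    | succ n ih =>
      have h1 := hA (s + n) (by have := n.cast_nonneg (α := ℝ); linarith) 1 (by simp)
      have h2 := abs_sub_le (h (s + n + 1)) (h (s + n)) (h s)
      push_cast
      rw [← add_assoc]
      linarith
  have fwd : ∀ s s' : ℝ, A ≤ s → s ≤ s' → |h s' - h s| ≤ ε * (|s' - s| + 1) := by
    intro s s' hs hss
    have hw : 0 ≤ s' - s := by linarith
    set n := ⌊s' - s⌋₊
    have hn := Nat.floor_le hw
    have hn' := (Nat.lt_floor_add_one (s' - s)).le
    have h1 := step n s hs
    have h2 := hA (s + n) (by have := n.cast_nonneg (α := ℝ); linarith) (s' - s - n)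
      ⟨by linarith, by linarith⟩
    rw [show s + n + (s' - s - n) = s' by ring] at h2
    have h3 := abs_sub_le (h s') (h (s + n)) (h s)
    rw [abs_of_nonneg hw]
    nlinarith
  refine ⟨A, fun s s' hs hs' => ?_⟩
  rcases le_total s s' with hle | hle
  · exact fwd s s' hs hle
  · rw [abs_sub_comm, abs_sub_comm s' s]
    exact fwd s' s hs' hle

theorem tendsto_sub (hh : IsSlowlyOscillating h) {ι : Type*} {l : Filter ι} {a b : ι → ℝ} {c : ℝ}
    (ha : Tendsto a l atTop) (hab : Tendsto (fun i => b i - a i) l (𝓝 c)) :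
    Tendsto (fun i => h (b i) - h (a i)) l (𝓝 0) := by
  have hb : Tendsto b l atTop := by
    have := ha.atTop_add hab
    simpa using this
  rw [Metric.tendsto_nhds]
  intro ε hε
  have hC : 0 < |c| + 3 := by positivity
  obtain ⟨A, hA⟩ := hh.potter (ε := ε / (|c| + 3)) (by positivity)
  filter_upwards [ha.eventually_ge_atTop A, hb.eventually_ge_atTop A,
    hab.abs.eventually (ge_mem_nhds (show |c| < |c| + 1 by linarith))] with i h1 h2 h3
  have h4 := hA _ _ h1 h2
  rw [Real.dist_eq, sub_zero]
  calc _ ≤ _ := h4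
    _ ≤ ε / (|c| + 3) * (|c| + 2) :=
      mul_le_mul_of_nonneg_left (by linarith) (div_pos hε hC).le
    _ < ε / (|c| + 3) * (|c| + 3) :=
      mul_lt_mul_of_pos_left (by linarith) (div_pos hε hC)
    _ = ε := by field_simp

theorem isLittleO (hh : IsSlowlyOscillating h) : h =o[atTop] (fun s : ℝ => s) := by
  rw [isLittleO_iff]
  intro ε hε
  obtain ⟨A, hA⟩ := hh.potter (ε := ε / 2) (by positivity)
  set B := max A 0
  filter_upwards [eventually_ge_atTop B, eventually_ge_atTop (2 * (|h B| + ε) / ε)] with s h1 h2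
  have h3 := hA B s (le_max_left _ _) ((le_max_left _ _).trans h1)
  have hB : 0 ≤ B := le_max_right _ _
  rw [div_le_iff₀ hε] at h2
  have h4 := abs_sub_abs_le_abs_sub (h s) (h B)
  rw [abs_of_nonneg (by linarith : 0 ≤ s - B)] at h3
  rw [Real.norm_eq_abs, Real.norm_eq_abs, abs_of_nonneg (hB.trans h1)]
  nlinarith

end IsSlowlyOscillating

/-! ### The slowly oscillating exponent of a Weibull-type density. -/

/-- The logarithm of the slowly varying part of the density of `Y ^ η`. -/
noncomputable def logDensityPart (η α : ℝ) (L : ℝ → ℝ) (s : ℝ) : ℝ :=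
  ((α + 1) / η - 1) * Real.log s + Real.log (L (Real.exp (Real.log s / η))) - Real.log η

namespace IsSlowlyVarying

variable {L : ℝ → ℝ}

theorem measurable_comp_exp (hL : IsSlowlyVarying L) : Measurable fun y => L (Real.exp y) :=
  hL.measurable_restrict.comp
    (f := fun y : ℝ => (⟨Real.exp y, Real.exp_pos y⟩ : Set.Ioi (0 : ℝ)))
    (Real.measurable_exp.subtype_mk)

theorem isSlowlyOscillating (hL : IsSlowlyVarying L) :
    IsSlowlyOscillating fun y => Real.log (L (Real.exp y)) := by
  refine isSlowlyOscillating_of_tendsto (Real.measurable_log.comp hL.measurable_comp_exp)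
    fun u => ?_
  have h1 := ((hL.tendsto_ratio (Real.exp u) (Real.exp_pos u)).comp Real.tendsto_exp_atTop).log
    one_ne_zero
  rw [Real.log_one] at h1
  refine h1.congr' ?_
  have p := hL.eventually_pos
  filter_upwards [Real.tendsto_exp_atTop.eventually p,
    (tendsto_atTop_add_const_right atTop u tendsto_id).eventually
      (Real.tendsto_exp_atTop.eventually p)] with y h2 h3
  simp only [id] at h3
  simp only [Function.comp]
  rw [← Real.exp_add, add_comm u y, Real.log_div h3.ne' h2.ne']

/-- Multiplying s by a factor near κ shifts log s by about log κ. The logarithmic term sees this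
shift, while the log L term, slowly oscillating in log s, does not. -/
theorem tendsto_logDensityPart_sub (hL : IsSlowlyVarying L) {η α κ : ℝ} (hη : 0 < η) (hκ : 0 < κ)
    {ι : Type*} {l : Filter ι} {a b : ι → ℝ}
    (ha : Tendsto a l atTop) (hab : Tendsto (fun i => b i / a i) l (𝓝 κ)) :
    Tendsto (fun i => logDensityPart η α L (b i) - logDensityPart η α L (a i)) l
      (𝓝 (((α + 1) / η - 1) * Real.log κ)) := by
  have hlog : Tendsto (fun i => Real.log (b i) - Real.log (a i)) l (𝓝 (Real.log κ)) := by
    refine (hab.log hκ.ne').congr' ?_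
    filter_upwards [ha.eventually_gt_atTop 0, hab.eventually (lt_mem_nhds hκ)] with i h1 h2
    have : 0 < b i := by
      rcases div_pos_iff.1 h2 with h | h
      · exact h.1
      · linarith [h.2]
    rw [Real.log_div this.ne' h1.ne']
  have h1 := hL.isSlowlyOscillating.tendsto_sub
    (a := fun i => Real.log (a i) / η) (b := fun i => Real.log (b i) / η) (l := l)
    (c := Real.log κ / η)
    ((Real.tendsto_log_atTop.comp ha).atTop_div_const hη)
    (by simpa [sub_div] using hlog.div_const η)
  have h2 := (hlog.const_mul ((α + 1) / η - 1)).add h1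
  rw [add_zero] at h2
  refine h2.congr fun i => ?_
  simp only [logDensityPart]; ring

theorem isSlowlyOscillating_logDensityPart (hL : IsSlowlyVarying L) {η α : ℝ} (hη : 0 < η) :
    IsSlowlyOscillating (logDensityPart η α L) := by
  by_contra hcon
  simp only [IsSlowlyOscillating, not_forall, not_exists, not_le] at hcon
  obtain ⟨ε, hε, hcon⟩ := hcon
  -- Along a sequence of counterexamples (s + u) / s tends to 1, so the preceding lemma with κ = 1
  -- applies and uniformity comes for free.
  choose s hs u hu hlt using fun n : ℕ => hcon n
  have hs' : Tendsto s atTop atTop := tendsto_atTop_mono hs tendsto_natCast_atTop_atTop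
  have hu0 : Tendsto (fun n => u n / s n) atTop (𝓝 0) := by
    refine squeeze_zero' ?_ ?_ (tendsto_inv_atTop_zero.comp hs')
    · filter_upwards [hs'.eventually_gt_atTop 0] with n hn using div_nonneg (hu n).1 hn.le
    · filter_upwards [hs'.eventually_gt_atTop 0] with n hn
      rw [Function.comp, div_eq_mul_inv]
      exact mul_le_of_le_one_left (inv_nonneg.2 hn.le) (hu n).2
  have h1 : Tendsto (fun n => (s n + u n) / s n) atTop (𝓝 1) := by
    have := hu0.const_add 1
    rw [add_zero] at this
    refine this.congr' ?_
    filter_upwards [hs'.eventually_gt_atTop 0] with n hn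
    field_simp
  have h2 := (hL.tendsto_logDensityPart_sub (α := α) hη one_pos hs' h1).abs
  rw [Real.log_one, mul_zero, abs_zero] at h2
  obtain ⟨n, hn⟩ := (h2.eventually (gt_mem_nhds hε)).exists
  exact absurd hn (hlt n).le.not_gt

end IsSlowlyVarying

/-! ### Exponentially regular functions. -/

/-- `φ` is measurable and equals `exp (-lam * s + ψ s)` for large `s`, where `lam > 0` and `ψ` is
slowly oscillating. -/
structure IsExpRegular (lam : ℝ) (ψ φ : ℝ → ℝ) : Prop where
  rate_pos : 0 < lam
  measurable : Measurable φ
  oscillating : IsSlowlyOscillating ψ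
  eventually_eq : ∀ᶠ s in atTop, φ s = Real.exp (-lam * s + ψ s)

namespace IsExpRegular

variable {lam : ℝ} {ψ φ : ℝ → ℝ}

theorem eventually_pos (h : IsExpRegular lam ψ φ) : ∀ᶠ s in atTop, 0 < φ s := by
  filter_upwards [h.eventually_eq] with s hs
  rw [hs]; exact Real.exp_pos _

theorem tendsto_ratio (h : IsExpRegular lam ψ φ) {ι : Type*} {l : Filter ι} {a : ι → ℝ}
    (ha : Tendsto a l atTop) (w : ℝ) :
    Tendsto (fun i => φ (a i + w) / φ (a i)) l (𝓝 (Real.exp (-lam * w))) := by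
  have h1 := h.oscillating.tendsto_sub ha (b := fun i => a i + w) (c := w)
    (by simpa using tendsto_const_nhds)
  have h2 := (h1.const_add (-lam * w)).rexp
  rw [add_zero] at h2
  refine h2.congr' ?_
  filter_upwards [ha.eventually h.eventually_eq,
    (tendsto_atTop_add_const_right l w ha).eventually h.eventually_eq] with i h3 h4
  rw [h3, h4, ← Real.exp_sub]
  congr 1; ring

theorem potter (h : IsExpRegular lam ψ φ) {ε : ℝ} (hε : 0 < ε) :
    ∃ A : ℝ, ∀ s s' : ℝ, A ≤ s → A ≤ s' → 0 < φ s ∧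
      φ s' ≤ Real.exp ε * Real.exp (-lam * (s' - s) + ε * |s' - s|) * φ s := by
  obtain ⟨A, hA⟩ := h.oscillating.potter hε
  obtain ⟨B, hB⟩ := eventually_atTop.1 h.eventually_eq
  refine ⟨max A B, fun s s' hs hs' => ?_⟩
  have h1 := hA s s' ((le_max_left _ _).trans hs) ((le_max_left _ _).trans hs')
  rw [hB s ((le_max_right _ _).trans hs), hB s' ((le_max_right _ _).trans hs')]
  refine ⟨Real.exp_pos _, ?_⟩
  rw [← Real.exp_add, ← Real.exp_add]
  apply Real.exp_le_exp.2
  have := (abs_le.1 h1).2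
  nlinarith

/-- After the shift by s the integrand tends to exp(-lam v). Potter's bound with `ε = lam / 2`
leaves the majorant a decay rate of lam / 2. -/
theorem tendsto_tail (h : IsExpRegular lam ψ φ) :
    Tendsto (fun s => (∫ v in Set.Ioi s, φ v) / φ s) atTop (𝓝 (1 / lam)) := by
  have hl := h.rate_pos
  obtain ⟨A, hA⟩ := h.potter (ε := lam / 2) (by positivity)
  have e : ∀ s, (∫ v in Set.Ioi s, φ v) / φ s = ∫ v in Set.Ioi (0 : ℝ), φ (s + v) / φ s := by
    intro s
    rw [integral_div]
    congr 1
    rw [← integral_indicator measurableSet_Ioi, ← integral_indicator measurableSet_Ioi,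
      ← integral_add_left_eq_self _ s]
    congr 1
    ext v
    simp [Set.indicator_apply]
  simp_rw [e]
  have lim : ∫ v in Set.Ioi (0 : ℝ), Real.exp (-lam * v) = 1 / lam := by
    rw [integral_exp_mul_Ioi (by linarith) 0]
    simp
  rw [← lim]
  refine tendsto_integral_filter_of_dominated_convergence
    (fun v => Real.exp (lam / 2) * Real.exp (-(lam / 2) * v)) ?_ ?_ ?_ ?_
  · exact Eventually.of_forall fun s =>
      ((h.measurable.comp (measurable_const_add s)).div_const _).aestronglyMeasurable
  · filter_upwards [eventually_ge_atTop A] with s hs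
    filter_upwards [ae_restrict_mem measurableSet_Ioi] with v hv
    have hv' : 0 < v := hv
    obtain ⟨p1, p2⟩ := hA s (s + v) hs (by linarith)
    obtain ⟨p3, -⟩ := hA (s + v) s (by linarith) hs
    rw [Real.norm_eq_abs, abs_of_pos (div_pos p3 p1), div_le_iff₀ p1]
    rw [show s + v - s = v by ring, abs_of_pos hv',
      show -lam * v + lam / 2 * v = -(lam / 2) * v by ring] at p2
    exact p2
  · exact (exp_neg_integrableOn_Ioi 0 (by positivity)).const_mul _
  · exact Eventually.of_forall fun v => h.tendsto_ratio tendsto_id v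

end IsExpRegular

/-! ### Passing to the scale of η-th powers. -/

/-- The density of `Y ^ η` on `(0, ∞)` when `Y` has density `f` there. -/
noncomputable def powDensity (η : ℝ) (f : ℝ → ℝ) (s : ℝ) : ℝ :=
  1 / η * s ^ (1 / η - 1) * f (s ^ (1 / η))

theorem integral_powDensity_mul {η : ℝ} (hη : 0 < η) (f q : ℝ → ℝ) :
    ∫ s in Set.Ioi (0 : ℝ), powDensity η f s * q (s ^ (1 / η)) =
      ∫ t in Set.Ioi (0 : ℝ), f t * q t := by
  rw [← integral_comp_rpow_Ioi (fun t => f t * q t) (p := 1 / η) (by positivity)]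
  congr 1
  ext s
  rw [abs_of_pos (by positivity), smul_eq_mul, powDensity]
  ring

theorem setIntegral_Ioi_powDensity {η : ℝ} (hη : 0 < η) (f : ℝ → ℝ) {s : ℝ} (hs : 0 ≤ s) :
    ∫ v in Set.Ioi s, powDensity η f v = ∫ t in Set.Ioi (s ^ (1 / η)), f t := by
  have h := integral_powDensity_mul hη f ((Set.Ioi (s ^ (1 / η))).indicator 1)
  have e1 : ∫ t in Set.Ioi (0 : ℝ), f t * (Set.Ioi (s ^ (1 / η))).indicator 1 t =
      ∫ t in Set.Ioi (s ^ (1 / η)), f t := by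
    rw [← integral_indicator measurableSet_Ioi, ← integral_indicator measurableSet_Ioi]
    congr 1
    ext t
    have : 0 ≤ s ^ (1 / η) := by positivity
    by_cases ht : s ^ (1 / η) < t
    · simp [Set.indicator_apply, this.trans_lt ht]
    · have : ¬ (s ^ η⁻¹ < t) := by simpa using ht
      simp [Set.indicator_apply, this]
  have e2 : ∫ v in Set.Ioi (0 : ℝ), powDensity η f v *
      (Set.Ioi (s ^ (1 / η))).indicator 1 (v ^ (1 / η)) = ∫ v in Set.Ioi s, powDensity η f v := by
    rw [← integral_indicator measurableSet_Ioi, ← integral_indicator measurableSet_Ioi]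
    congr 1
    ext t
    by_cases ht : 0 < t
    · have : s ^ (1 / η) < t ^ (1 / η) ↔ s < t :=
        Real.rpow_lt_rpow_iff hs ht.le (by positivity)
      by_cases h' : s < t
      · simp only [Set.indicator_apply, Set.mem_Ioi, ht, h', this.2 h', if_true, Pi.one_apply,
          mul_one]
      · simp only [Set.indicator_apply, Set.mem_Ioi, this, h', if_false, mul_zero, ite_self]
    · have : ¬ s < t := by linarith
      simp [Set.indicator_apply, ht, this]
  rw [← e1, ← e2, h]

theorem IsWeibullTypeDensity.isExpRegular {lam η α : ℝ} {L f : ℝ → ℝ} (hη : 0 < η)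
    (hlam : 0 < lam) (hf : IsWeibullTypeDensity lam η α L f) (hm : Measurable f) :
    IsExpRegular lam (logDensityPart η α L) (powDensity η f) where
  rate_pos := hlam
  measurable := by unfold powDensity; fun_prop
  oscillating := hf.slowlyVarying.isSlowlyOscillating_logDensityPart hη
  eventually_eq := by
    have h1 := ((tendsto_rpow_atTop (y := 1 / η) (by positivity)).eventually
      hf.slowlyVarying.eventually_pos)
    filter_upwards [h1, eventually_gt_atTop 0] with s hs hs0
    have e : Real.exp (Real.log s / η) = s ^ (1 / η) := by
      rw [Real.rpow_def_of_pos hs0]; congr 1; ring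
    rw [powDensity, hf.eq_form _ (by positivity), logDensityPart, e, Real.exp_add, Real.exp_sub,
      Real.exp_add, Real.exp_log hs, Real.exp_log hη, ← Real.rpow_mul hs0.le, ← Real.rpow_mul hs0.le,
      one_div_mul_cancel hη.ne', Real.rpow_one, mul_comm _ (Real.log s), ← Real.rpow_def_of_pos hs0,
      show (α + 1) / η - 1 = (1 / η - 1) + 1 / η * α by ring, Real.rpow_add hs0]
    ring

/-! ### Total time for a fixed task time. -/

/-- The failure times `U 0, U 1, …` are measurable, i.i.d., almost surely positive and
integrable. -/
structure IsFailureSequence {Ω : Type*} [MeasurableSpace Ω] (P : Measure Ω) (U : ℕ → Ω → ℝ) :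
    Prop where
  measurable : ∀ i, Measurable (U i)
  indep : iIndepFun U P
  identDistrib : ∀ i, IdentDistrib (U i) (U 0) P P
  pos : ∀ᵐ ω ∂P, 0 < U 0 ω
  integrable : Integrable (U 0) P

theorem one_sub_pow_le_exp {p : ℝ} (h1 : p ≤ 1) (n : ℕ) :
    (1 - p) ^ n ≤ Real.exp (-(n * p)) := by
  calc (1 - p) ^ n ≤ Real.exp (-p) ^ n :=
        pow_le_pow_left₀ (by linarith) (Real.one_sub_le_exp_neg p) n
    _ = _ := by rw [← Real.exp_nat_mul]; congr 1; ring

theorem exp_le_one_sub_pow {p : ℝ} (h1 : p < 1) (n : ℕ) :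
    Real.exp (-(n * p / (1 - p))) ≤ (1 - p) ^ n := by
  have h : Real.exp (-(p / (1 - p))) ≤ 1 - p := by
    have h0 : 0 < 1 - p := by linarith
    rw [← Real.le_log_iff_exp_le h0]
    refine le_trans (le_of_eq ?_) (Real.one_sub_inv_le_log_of_pos h0)
    field_simp; ring
  calc Real.exp (-(n * p / (1 - p))) = Real.exp (-(p / (1 - p))) ^ n := by
        rw [← Real.exp_nat_mul]; congr 1; ring
    _ ≤ _ := pow_le_pow_left₀ (Real.exp_pos _).le h n

namespace IsFailureSequence

variable {Ω : Type*} [MeasurableSpace Ω] {P : Measure Ω} {U : ℕ → Ω → ℝ}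

theorem ae_all_pos (h : IsFailureSequence P U) : ∀ᵐ ω ∂P, ∀ i, 0 < U i ω := by
  rw [ae_all_iff]
  exact fun i => (h.identDistrib i).symm.ae_snd (p := fun x => 0 < x) measurableSet_Ioi h.pos

variable [IsProbabilityMeasure P]

theorem mean_pos (h : IsFailureSequence P U) : 0 < ∫ ω, U 0 ω ∂P := by
  rw [integral_pos_iff_support_of_nonneg_ae (h.pos.mono fun _ h => h.le) h.integrable]
  have : Function.support (U 0) =ᵐ[P] Set.univ := by
    filter_upwards [h.pos] with ω hω
    exact propext ⟨fun _ => trivial, fun _ => hω.ne'⟩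
  rw [measure_congr this]
  simp

theorem measureReal_run (h : IsFailureSequence P U) (t : ℝ) (n : ℕ) :
    P.real {ω | ∀ i < n, U i ω ≤ t} = (1 - P.real {ω | t < U 0 ω}) ^ n := by
  have e1 : {ω | ∀ i < n, U i ω ≤ t} = ⋂ i ∈ Finset.range n, U i ⁻¹' Set.Iic t := by
    ext ω; simp
  have e2 : ∀ i, P (U i ⁻¹' Set.Iic t) = P (U 0 ⁻¹' Set.Iic t) := fun i =>
    (h.identDistrib i).measure_mem_eq measurableSet_Iic
  have e3 : P.real (U 0 ⁻¹' Set.Iic t) = 1 - P.real {ω | t < U 0 ω} := by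
    rw [← probReal_compl_eq_one_sub (measurableSet_lt measurable_const (h.measurable 0))]
    congr 1
    ext ω; simp
  rw [← e3, e1, Measure.real, h.indep.measure_inter_preimage_eq_mul _ fun _ _ => measurableSet_Iic]
  simp [e2, Measure.real]

theorem ae_exists_gt (h : IsFailureSequence P U) {t : ℝ} (hp : 0 < P.real {ω | t < U 0 ω}) :
    ∀ᵐ ω ∂P, ∃ i, t < U i ω := by
  have hle : ∀ n : ℕ, P.real {ω | ¬ ∃ i, t < U i ω} ≤ (1 - P.real {ω | t < U 0 ω}) ^ n := by
    intro n
    rw [← h.measureReal_run]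
    refine measureReal_mono fun ω hω i _ => ?_
    simp only [Set.mem_ofPred_eq, not_exists, not_lt] at hω
    exact hω i
  have h0 := tendsto_pow_atTop_nhds_zero_of_lt_one
    (r := 1 - P.real {ω | t < U 0 ω}) (by linarith [measureReal_le_one (μ := P) (s := {ω | t < U 0 ω})])
    (by linarith)
  have h1 : P.real {ω | ¬ ∃ i, t < U i ω} = 0 :=
    le_antisymm (ge_of_tendsto' h0 hle) measureReal_nonneg
  rw [ae_iff]
  exact (measureReal_eq_zero_iff).1 h1

/-- Either the first `n` failures all stay below `t`, or the count is less than `n` and every summed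
failure is at most `t`. Truncating at `t` then changes nothing, and it supplies exponential moments
that the failure times themselves may lack. -/
theorem totalTimeTail_le (h : IsFailureSequence P U) {t : ℝ} (ht : 0 ≤ t) (x : ℝ) (n : ℕ) :
    totalTimeTail P (fun _ => t) U x ≤ (1 - P.real {ω | t < U 0 ω}) ^ n +
      P.real {ω | x < t + ∑ i ∈ Finset.range n, min (U i ω) t} := by
  rw [← h.measureReal_run]
  refine le_trans ?_ (measureReal_union_le _ _)
  refine ENNReal.toReal_mono (measure_ne_top _ _) (measure_mono_ae ?_)
  filter_upwards [h.ae_all_pos] with ω hpos hx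
  change x < t + ∑ i ∈ Finset.range (sInf {n : ℕ | t < U n ω}), U i ω at hx
  by_cases hrun : ∀ i < n, U i ω ≤ t
  · exact Or.inl hrun
  · right
    push Not at hrun
    obtain ⟨i, hi, hti⟩ := hrun
    have hN : sInf {n : ℕ | t < U n ω} < n := (Nat.sInf_le (s := {n : ℕ | t < U n ω}) hti).trans_lt hi
    refine hx.trans_le ?_
    gcongr 1
    · calc _ = ∑ i ∈ Finset.range (sInf {n : ℕ | t < U n ω}), min (U i ω) t := by
            refine Finset.sum_congr rfl fun j hj => ?_
            have := Nat.notMem_of_lt_sInf (Finset.mem_range.1 hj)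
            simp only [Set.mem_ofPred_eq, not_lt] at this
            rw [min_eq_left this]
        _ ≤ _ := Finset.sum_le_sum_of_subset_of_nonneg
            (Finset.range_subset_range.2 hN.le) fun j _ _ => le_min (hpos j).le ht

theorem le_totalTimeTail (h : IsFailureSequence P U) {t : ℝ} (ht : 0 ≤ t)
    (hp : 0 < P.real {ω | t < U 0 ω}) (x : ℝ) (n : ℕ) :
    (1 - P.real {ω | t < U 0 ω}) ^ n - P.real {ω | ∑ i ∈ Finset.range n, U i ω ≤ x} ≤
      totalTimeTail P (fun _ => t) U x := by
  rw [← h.measureReal_run, sub_le_iff_le_add]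
  refine le_trans ?_ (measureReal_union_le _ _)
  refine ENNReal.toReal_mono (measure_ne_top _ _) (measure_mono_ae ?_)
  -- An exceedance must exist: otherwise `sInf ∅ = 0` would make the count 0 despite an endless run.
  filter_upwards [h.ae_all_pos, h.ae_exists_gt hp] with ω hpos hex hrun
  by_cases hx : ∑ i ∈ Finset.range n, U i ω ≤ x
  · exact Or.inr hx
  · left
    change x < t + ∑ i ∈ Finset.range (sInf {n : ℕ | t < U n ω}), U i ω
    have hN : n ≤ sInf {n : ℕ | t < U n ω} := by
      by_contra hlt
      exact absurd (Nat.sInf_mem (s := {n : ℕ | t < U n ω}) hex)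
        (not_lt.2 (hrun _ (not_le.1 hlt)))
    have : ∑ i ∈ Finset.range n, U i ω ≤ ∑ i ∈ Finset.range (sInf {n : ℕ | t < U n ω}), U i ω :=
      Finset.sum_le_sum_of_subset_of_nonneg (Finset.range_subset_range.2 hN)
        fun j _ _ => (hpos j).le
    linarith

theorem mul_tail_le_mean (h : IsFailureSequence P U) (t : ℝ) :
    t * P.real {ω | t < U 0 ω} ≤ ∫ ω, U 0 ω ∂P := by
  rcases le_total t 0 with ht | ht
  · exact (mul_nonpos_of_nonpos_of_nonneg ht measureReal_nonneg).trans h.mean_pos.le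
  refine le_trans (mul_le_mul_of_nonneg_left (measureReal_mono fun ω hω => ?_) ht)
    (mul_meas_ge_le_integral_of_nonneg (h.pos.mono fun _ h => h.le) h.integrable t)
  exact le_of_lt (show t < U 0 ω from hω)

/-- The parameter p = P(U > t) is the right size: by Markov p t ≤ m, so the exponent stays in [0,
m], where exp z ≤ 1 + z exp m. -/
theorem mgf_min_le (h : IsFailureSequence P U) {t : ℝ} (ht : 0 ≤ t) (i : ℕ) :
    mgf (fun ω => min (U i ω) t) P (P.real {ω | t < U 0 ω}) ≤
      Real.exp (P.real {ω | t < U 0 ω} * ((∫ ω, U 0 ω ∂P) * Real.exp (∫ ω, U 0 ω ∂P))) := by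
  set p := P.real {ω | t < U 0 ω}
  set m := ∫ ω, U 0 ω ∂P
  have hp : 0 ≤ p := measureReal_nonneg
  have hpt : t * p ≤ m := h.mul_tail_le_mean t
  have hi : Integrable (U i) P := (h.identDistrib i).symm.integrable_snd h.integrable
  have hmi : ∫ ω, U i ω ∂P = m := (h.identDistrib i).integral_eq
  have hbound : ∀ᵐ ω ∂P, Real.exp (p * min (U i ω) t) ≤ 1 + p * Real.exp m * U i ω := by
    filter_upwards [h.ae_all_pos] with ω hω
    have hz0 : 0 ≤ min (U i ω) t := le_min (hω i).le ht
    have hz : 0 ≤ p * min (U i ω) t := mul_nonneg hp hz0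
    have hzm : p * min (U i ω) t ≤ m := by
      refine le_trans (mul_le_mul_of_nonneg_left (min_le_right _ _) hp) (by linarith)
    have h1 : Real.exp (p * min (U i ω) t) ≤
        1 + p * min (U i ω) t * Real.exp (p * min (U i ω) t) := by
      have h2 := Real.one_sub_le_exp_neg (p * min (U i ω) t)
      have h3 := mul_le_mul_of_nonneg_right h2 (Real.exp_pos (p * min (U i ω) t)).le
      rw [← Real.exp_add, neg_add_cancel, Real.exp_zero] at h3
      linarith
    refine h1.trans ?_
    have h4 : p * min (U i ω) t * Real.exp (p * min (U i ω) t) ≤ p * U i ω * Real.exp m :=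
      mul_le_mul (mul_le_mul_of_nonneg_left (min_le_left _ _) hp) (Real.exp_le_exp.2 hzm)
        (Real.exp_pos _).le (mul_nonneg hp (hω i).le)
    linarith
  have hR : Integrable (fun ω => 1 + p * Real.exp m * U i ω) P :=
    (integrable_const 1).add (hi.const_mul _)
  calc mgf (fun ω => min (U i ω) t) P p ≤ ∫ ω, (1 + p * Real.exp m * U i ω) ∂P := by
        refine integral_mono_of_nonneg (Eventually.of_forall fun _ => (Real.exp_pos _).le) hR hbound
    _ = 1 + p * Real.exp m * m := by
        rw [integral_add (integrable_const 1) (hi.const_mul _), integral_const_mul, hmi]; simp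
    _ ≤ _ := by
        have := Real.add_one_le_exp (p * (m * Real.exp m))
        linarith

theorem measureReal_min_sum_le (h : IsFailureSequence P U) {t : ℝ} (ht : 0 ≤ t) (x : ℝ) (n : ℕ) :
    P.real {ω | x < t + ∑ i ∈ Finset.range n, min (U i ω) t} ≤
      Real.exp (-P.real {ω | t < U 0 ω} * (x - t)) * Real.exp (P.real {ω | t < U 0 ω} *
        ((∫ ω, U 0 ω ∂P) * Real.exp (∫ ω, U 0 ω ∂P))) ^ n := by
  set p := P.real {ω | t < U 0 ω}
  set m := ∫ ω, U 0 ω ∂P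
  have hp : 0 ≤ p := measureReal_nonneg
  set Y : ℕ → Ω → ℝ := fun i ω => min (U i ω) t with hY
  have hYm : ∀ i, Measurable (Y i) := fun i => (h.measurable i).min measurable_const
  have hYi : iIndepFun Y P := h.indep.comp (fun _ z => min z t) fun _ => by fun_prop
  have hSm : Measurable (∑ i ∈ Finset.range n, Y i) := by
    simp only [Finset.sum_fn]
    exact Finset.measurable_sum _ fun i _ => hYm i
  have hint : Integrable (fun ω => Real.exp (p * (∑ i ∈ Finset.range n, Y i) ω)) P := by
    refine Integrable.of_bound (C := Real.exp (p * (n * t))) (by fun_prop) (Eventually.of_forall fun ω => ?_)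
    rw [Real.norm_eq_abs, Real.abs_exp, Finset.sum_apply]
    refine Real.exp_le_exp.2 (mul_le_mul_of_nonneg_left ?_ hp)
    calc ∑ i ∈ Finset.range n, Y i ω ≤ ∑ i ∈ Finset.range n, t :=
          Finset.sum_le_sum fun i _ => min_le_right _ _
      _ = n * t := by simp
  have h1 := measure_ge_le_exp_mul_mgf (μ := P) (x - t) hp hint
  rw [hYi.mgf_sum hYm] at h1
  refine le_trans (measureReal_mono fun ω hω => ?_) (h1.trans ?_)
  · simp only [Set.mem_ofPred_eq, Finset.sum_apply] at hω ⊢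
    simp only [hY]; linarith
  · refine mul_le_mul_of_nonneg_left ?_ (Real.exp_pos _).le
    calc _ ≤ ∏ i ∈ Finset.range n, Real.exp (p * (m * Real.exp m)) :=
          Finset.prod_le_prod (fun i _ => mgf_nonneg) fun i _ => h.mgf_min_le ht i
      _ = _ := by simp

/-- An exponential bound for the total time with a fixed task time, uniform in the task time. -/
theorem exists_totalTimeTail_le_exp (h : IsFailureSequence P U) :
    ∃ C c : ℝ, 0 < C ∧ 0 < c ∧ ∀ t : ℝ, 0 ≤ t → ∀ x : ℝ, 0 ≤ x →
      totalTimeTail P (fun _ => t) U x ≤ C * Real.exp (-(c * (x * P.real {ω | t < U 0 ω}))) := by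
  set m := ∫ ω, U 0 ω ∂P
  have hm : 0 < m := h.mean_pos
  set K := m * Real.exp m
  have hK : 0 < K := by positivity
  refine ⟨Real.exp 1 + Real.exp m, min (1 / 2) (1 / (2 * K)), by positivity, by positivity,
    fun t ht x hx => ?_⟩
  set p := P.real {ω | t < U 0 ω}
  have hp : 0 ≤ p := measureReal_nonneg
  have hp1 : p ≤ 1 := measureReal_le_one
  have hpt : t * p ≤ m := h.mul_tail_le_mean t
  -- This `n` makes the Chernoff cost n p K at most half of the gain p x, while (1 - p)^n still
  -- decays like exp(-x p / (2K)). The floor costs the factor exp 1, and exp(p t) ≤ exp m gives the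
  -- other constant.
  set n := ⌊x / (2 * K)⌋₊
  have hn : (n : ℝ) ≤ x / (2 * K) := Nat.floor_le (by positivity)
  have hn' : x / (2 * K) < n + 1 := Nat.lt_floor_add_one _
  have hxp : 0 ≤ x * p := by positivity
  have b1 : (1 - p) ^ n ≤ Real.exp 1 * Real.exp (-(min (1 / 2) (1 / (2 * K)) * (x * p))) := by
    refine (one_sub_pow_le_exp hp1 n).trans ?_
    rw [← Real.exp_add]
    apply Real.exp_le_exp.2
    have h1 : min (1 / 2) (1 / (2 * K)) * (x * p) ≤ 1 / (2 * K) * (x * p) :=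
      mul_le_mul_of_nonneg_right (min_le_right _ _) hxp
    have h2 : 1 / (2 * K) * (x * p) = x / (2 * K) * p := by ring
    have h3 : x / (2 * K) * p ≤ (n + 1) * p := mul_le_mul_of_nonneg_right hn'.le hp
    linarith
  have b2 : Real.exp (-p * (x - t)) * Real.exp (p * K) ^ n ≤
      Real.exp m * Real.exp (-(min (1 / 2) (1 / (2 * K)) * (x * p))) := by
    rw [← Real.exp_nat_mul, ← Real.exp_add, ← Real.exp_add]
    apply Real.exp_le_exp.2
    have h1 : min (1 / 2) (1 / (2 * K)) * (x * p) ≤ 1 / 2 * (x * p) :=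
      mul_le_mul_of_nonneg_right (min_le_left _ _) hxp
    have h2 : (n : ℝ) * (p * K) ≤ x / (2 * K) * (p * K) :=
      mul_le_mul_of_nonneg_right hn (by positivity)
    have h3 : x / (2 * K) * (p * K) = 1 / 2 * (x * p) := by field_simp
    linarith
  calc _ ≤ _ := h.totalTimeTail_le ht x n
    _ ≤ _ := add_le_add b1 ((h.measureReal_min_sum_le ht x n).trans b2)
    _ = _ := by ring

theorem tendsto_measureReal_mean_sub_ge (h : IsFailureSequence P U) {ε : ℝ} (hε : 0 < ε) :
    Tendsto (fun n : ℕ => P.real {ω | ε ≤ |(∑ i ∈ Finset.range n, U i ω) / n - ∫ ω, U 0 ω ∂P|})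
      atTop (𝓝 0) := by
  have h1 := strong_law_ae_real U h.integrable (fun i j hij => h.indep.indepFun hij) h.identDistrib
  have h2 := tendstoInMeasure_of_tendsto_ae (μ := P)
    (f := fun (n : ℕ) ω => (∑ i ∈ Finset.range n, U i ω) / n)
    (fun n => ((Finset.measurable_sum _ fun i _ => h.measurable i).div_const _).aestronglyMeasurable)
    h1
  rw [tendstoInMeasure_iff_measureReal_dist] at h2
  exact h2 ε hε

/-- For a fixed large task time, the total time is asymptotically exponential. -/
theorem tendsto_totalTimeTail (h : IsFailureSequence P U) {ι : Type*} {l : Filter ι}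
    {x t : ι → ℝ} {y : ℝ} (hx : Tendsto x l atTop) (ht : ∀ᶠ i in l, 0 ≤ t i)
    (htx : Tendsto (fun i => t i / x i) l (𝓝 0))
    (hp : ∀ᶠ i in l, 0 < P.real {ω | t i < U 0 ω})
    (hxp : Tendsto (fun i => x i * P.real {ω | t i < U 0 ω}) l (𝓝 y)) :
    Tendsto (fun i => totalTimeTail P (fun _ => t i) U (x i)) l
      (𝓝 (Real.exp (-(y / ∫ ω, U 0 ω ∂P)))) := by
  set m := ∫ ω, U 0 ω ∂P
  have hm : 0 < m := h.mean_pos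
  have hpn : ∀ c : ℝ, 0 < c → Tendsto
      (fun i => (⌊c / m * x i⌋₊ : ℝ) * P.real {ω | t i < U 0 ω}) l (𝓝 (c / m * y)) := by
    intro c hc
    have h1 := ((tendsto_nat_floor_mul_div_atTop (div_pos hc hm).le).comp hx).mul hxp
    refine h1.congr' ?_
    filter_upwards [hx.eventually_gt_atTop 0] with i hi
    simp only [Function.comp]
    field_simp
  have hn : ∀ c : ℝ, 0 < c → Tendsto (fun i => ⌊c / m * x i⌋₊) l atTop := fun c hc =>
    tendsto_nat_floor_atTop.comp (hx.const_mul_atTop (div_pos hc hm))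
  have hp0 : Tendsto (fun i => P.real {ω | t i < U 0 ω}) l (𝓝 0) := by
    have := hxp.mul (tendsto_inv_atTop_zero.comp hx)
    rw [mul_zero] at this
    refine this.congr' ?_
    filter_upwards [hx.eventually_gt_atTop 0] with i hi
    simp only [Function.comp]
    field_simp
  have hcont : Tendsto (fun c : ℝ => Real.exp (-(c / m * y))) (𝓝 1) (𝓝 (Real.exp (-(y / m)))) := by
    have : Continuous fun c : ℝ => Real.exp (-(c / m * y)) := by fun_prop
    convert this.tendsto 1 using 3
    ring
  refine tendsto_order.2 ⟨fun a ha => ?_, fun b hb => ?_⟩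
  -- Lower bound: with c > 1, a run of about c x / m failures below `t` already lasts longer than x,
  -- except on an event of vanishing probability.
  · obtain ⟨c, hc, hc1⟩ : ∃ c : ℝ, a < Real.exp (-(c / m * y)) ∧ 1 < c :=
      (((hcont.mono_left nhdsWithin_le_nhds).eventually (lt_mem_nhds ha)).and
        (self_mem_nhdsWithin : Set.Ioi (1 : ℝ) ∈ 𝓝[>] 1)).exists
    have hc0 : 0 < c := by linarith
    have l1 : Tendsto (fun i => Real.exp (-(⌊c / m * x i⌋₊ * P.real {ω | t i < U 0 ω} /
        (1 - P.real {ω | t i < U 0 ω})))) l (𝓝 (Real.exp (-(c / m * y)))) := by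
      have := ((hpn c hc0).div (hp0.const_sub 1) (by norm_num)).neg.rexp
      simpa using this
    -- Half the gap between m and m / c: the other half absorbs the floor.
    have hδ : 0 < m * (1 - 1 / c) / 2 := by
      have : 1 / c < 1 := (div_lt_one hc0).2 hc1
      have : 0 < 1 - 1 / c := by linarith
      positivity
    have l2 := (h.tendsto_measureReal_mean_sub_ge hδ).comp (hn c hc0)
    have l3 := l1.sub l2
    rw [sub_zero] at l3
    have hlarge : ∀ᶠ i in l, x i / ⌊c / m * x i⌋₊ ≤ m / c + m * (1 - 1 / c) / 2 := by
      have h1 := ((tendsto_nat_floor_mul_div_atTop (div_pos hc0 hm).le).comp hx).inv₀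
        (div_pos hc0 hm).ne'
      have hlt : (c / m)⁻¹ < m / c + m * (1 - 1 / c) / 2 := by rw [inv_div]; linarith
      filter_upwards [h1.eventually (ge_mem_nhds hlt)] with i hi
      simpa [Function.comp, inv_div] using hi
    filter_upwards [l3.eventually (lt_mem_nhds hc), ht, hp, hlarge,
      hp0.eventually (gt_mem_nhds zero_lt_one),
      (hn c hc0).eventually_gt_atTop 0] with i k1 k2 k3 k4 k5 k6
    refine lt_of_lt_of_le k1 (le_trans ?_ (h.le_totalTimeTail k2 k3 (x i) ⌊c / m * x i⌋₊))
    refine sub_le_sub (exp_le_one_sub_pow k5 _) (measureReal_mono fun ω hω => ?_)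
    simp only [Set.mem_ofPred_eq] at hω ⊢
    have h5 : (∑ j ∈ Finset.range ⌊c / m * x i⌋₊, U j ω) / (⌊c / m * x i⌋₊ : ℝ) ≤
        m / c + m * (1 - 1 / c) / 2 := (div_le_div_of_nonneg_right hω (by positivity)).trans k4
    rw [abs_sub_comm]
    refine le_trans ?_ (le_abs_self _)
    have : m / c = m - m * (1 - 1 / c) := by ring
    linarith
  -- Upper bound: with c < 1, about c x / m failures rarely reach x - t, because t / x → 0.
  · obtain ⟨c, ⟨hc, hc0⟩, hc1⟩ : ∃ c : ℝ, (Real.exp (-(c / m * y)) < b ∧ 0 < c) ∧ c < 1 :=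
      ((((hcont.mono_left nhdsWithin_le_nhds).eventually (gt_mem_nhds hb)).and
        (nhdsWithin_le_nhds (lt_mem_nhds zero_lt_one))).and
        (self_mem_nhdsWithin : Set.Iio (1 : ℝ) ∈ 𝓝[<] 1)).exists
    have hδ : 0 < m * (1 / c - 1) / 2 := by
      have : 1 < 1 / c := (one_lt_div hc0).2 hc1
      have : 0 < 1 / c - 1 := by linarith
      positivity
    have l2 := (h.tendsto_measureReal_mean_sub_ge hδ).comp (hn c hc0)
    have l3 := ((hpn c hc0).neg.rexp).add l2
    rw [add_zero] at l3
    have hlarge : ∀ᶠ i in l, m / c - m * (1 / c - 1) / 2 ≤ (x i - t i) / ⌊c / m * x i⌋₊ := by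
      have h1 := (((tendsto_nat_floor_mul_div_atTop (div_pos hc0 hm).le).comp hx).inv₀
        (div_pos hc0 hm).ne').mul (htx.const_sub 1)
      have hlt : m / c - m * (1 / c - 1) / 2 < (c / m)⁻¹ * (1 - 0) := by rw [inv_div]; linarith
      filter_upwards [h1.eventually (le_mem_nhds hlt), hx.eventually_gt_atTop 0] with i hi hi0
      refine hi.trans (le_of_eq ?_)
      simp only [Function.comp, inv_div]
      field_simp
    filter_upwards [l3.eventually (gt_mem_nhds hc), ht, hlarge] with i k1 k2 k4
    refine lt_of_le_of_lt ((h.totalTimeTail_le k2 (x i) ⌊c / m * x i⌋₊).trans ?_) k1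
    refine add_le_add (one_sub_pow_le_exp measureReal_le_one _) (measureReal_mono fun ω hω => ?_)
    simp only [Set.mem_ofPred_eq] at hω ⊢
    have h4 : ∑ j ∈ Finset.range ⌊c / m * x i⌋₊, min (U j ω) (t i) ≤
        ∑ j ∈ Finset.range ⌊c / m * x i⌋₊, U j ω := Finset.sum_le_sum fun j _ => min_le_left _ _
    have h5 : (x i - t i) / (⌊c / m * x i⌋₊ : ℝ) ≤
        (∑ j ∈ Finset.range ⌊c / m * x i⌋₊, U j ω) / (⌊c / m * x i⌋₊ : ℝ) :=
      div_le_div_of_nonneg_right (by linarith) (by positivity)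
    refine le_trans ?_ (le_abs_self _)
    have : m / c = m + m * (1 / c - 1) := by ring
    linarith

end IsFailureSequence

/-! ### Consequences of the density; integrability of the failure times. -/

namespace HasPositiveDensity

variable {Ω : Type*} [MeasurableSpace Ω] {P : Measure Ω} {Y : Ω → ℝ} {f : ℝ → ℝ}

theorem measureReal_gt (h : HasPositiveDensity P Y f) {t : ℝ} (ht : 0 ≤ t) :
    P.real {ω | t < Y ω} = ∫ v in Set.Ioi t, f v := by
  have e1 : P {ω | t < Y ω} = (P.map Y) (Set.Ioi t) := by
    rw [Measure.map_apply_of_aemeasurable h.hasLaw.aemeasurable measurableSet_Ioi]; rfl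
  rw [Measure.real, e1, h.hasLaw.map_eq, withDensity_apply _ measurableSet_Ioi,
    Measure.restrict_restrict measurableSet_Ioi,
    Set.inter_eq_left.2 (Set.Ioi_subset_Ioi ht), integral_eq_lintegral_of_nonneg_ae]
  · filter_upwards [ae_restrict_mem measurableSet_Ioi] with v hv
    exact h.nonneg_density v (ht.trans_lt hv)
  · exact h.measurable_density.aestronglyMeasurable

theorem ae_pos (h : HasPositiveDensity P Y f) : ∀ᵐ ω ∂P, 0 < Y ω := by
  have h1 : ∀ᵐ y ∂(P.map Y), 0 < y := by
    rw [h.hasLaw.map_eq]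
    exact (withDensity_absolutelyContinuous _ _).ae_le (ae_restrict_mem measurableSet_Ioi)
  exact ae_of_ae_map h.hasLaw.aemeasurable h1

theorem integral_comp_eq (h : HasPositiveDensity P Y f) {q : ℝ → ℝ} :
    ∫ y, q y ∂(P.map Y) = ∫ t in Set.Ioi (0 : ℝ), f t * q t := by
  rw [h.hasLaw.map_eq, integral_withDensity_eq_integral_toReal_smul
    h.measurable_density.ennreal_ofReal (Eventually.of_forall fun _ => ENNReal.ofReal_lt_top)]
  refine setIntegral_congr_fun measurableSet_Ioi fun t ht => ?_
  simp only [smul_eq_mul]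
  rw [ENNReal.toReal_ofReal (h.nonneg_density t ht)]

theorem integrableOn [IsProbabilityMeasure P] (h : HasPositiveDensity P Y f) :
    IntegrableOn f (Set.Ioi 0) := by
  refine ⟨h.measurable_density.aestronglyMeasurable, ?_⟩
  rw [hasFiniteIntegral_iff_ofReal]
  · have : IsProbabilityMeasure (P.map Y) := Measure.isProbabilityMeasure_map h.hasLaw.aemeasurable
    have h1 := measure_lt_top (P.map Y) Set.univ
    rwa [h.hasLaw.map_eq, withDensity_apply _ MeasurableSet.univ, Measure.restrict_univ] at h1
  · filter_upwards [ae_restrict_mem measurableSet_Ioi] with v hv using h.nonneg_density v hv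

theorem integrable_of_isWeibullTypeDensity [IsProbabilityMeasure P] (h : HasPositiveDensity P Y f)
    {lam η α : ℝ} {L : ℝ → ℝ} (hη : 0 < η) (hlam : 0 < lam)
    (hf : IsWeibullTypeDensity lam η α L f) : Integrable Y P := by
  have hlaw := h.hasLaw
  suffices H : Integrable (fun y : ℝ => y) (P.map Y) from
    H.comp_aemeasurable hlaw.aemeasurable
  rw [hlaw.map_eq, integrable_withDensity_iff_integrable_smul'
    h.measurable_density.ennreal_ofReal (Eventually.of_forall fun _ => ENNReal.ofReal_lt_top)]
  have H : IntegrableOn (fun t => f t * t) (Set.Ioi 0) := by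
    have hlo := hf.slowlyVarying.isSlowlyOscillating.isLittleO.bound (c := 1) one_pos
    -- Since log L(exp y) = o(y), a slowly varying function is eventually below any positive power.
    have hL : ∀ᶠ t in atTop, L t ≤ t := by
      filter_upwards [Real.tendsto_log_atTop.eventually hlo, hf.slowlyVarying.eventually_pos,
        eventually_gt_atTop 1] with t h1 h2 h3
      have ht0 : 0 < t := by linarith
      rw [Real.exp_log ht0, one_mul, Real.norm_eq_abs, Real.norm_eq_abs,
        abs_of_pos (Real.log_pos h3)] at h1
      exact (Real.log_le_log_iff h2 ht0).1 ((le_abs_self _).trans h1)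
    obtain ⟨B, hB⟩ := eventually_atTop.1 (hL.and (eventually_ge_atTop (1 : ℝ)))
    have hB1 : 1 ≤ B := (hB B le_rfl).2
    rw [← Set.Ioc_union_Ioi_eq_Ioi (show (0 : ℝ) ≤ B by linarith)]
    refine IntegrableOn.union ?_ ?_
    · refine Integrable.mono' ((h.integrableOn.mono_set Set.Ioc_subset_Ioi_self).mul_const B)
        (h.measurable_density.mul measurable_id).aestronglyMeasurable ?_
      filter_upwards [ae_restrict_mem measurableSet_Ioc] with t ht
      have hft := h.nonneg_density t ht.1
      rw [Real.norm_eq_abs, abs_of_nonneg (mul_nonneg hft ht.1.le)]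
      exact mul_le_mul_of_nonneg_left ht.2 hft
    -- The maximum with 0 keeps the exponent above -1, as integrability at 0 requires; it only
    -- enlarges the bound since t > 1.
    · refine Integrable.mono' ((integrableOn_rpow_mul_exp_neg_mul_rpow (s := max (α + 2) 0)
        (by linarith [le_max_right (α + 2) 0]) hη hlam).mono_set
        (Set.Ioi_subset_Ioi (show (0 : ℝ) ≤ B by linarith)))
        (h.measurable_density.mul measurable_id).aestronglyMeasurable ?_
      filter_upwards [ae_restrict_mem measurableSet_Ioi] with t ht
      have htB : B < t := ht
      have ht0 : 0 < t := by linarith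
      have hft := h.nonneg_density t ht0
      rw [Real.norm_eq_abs, abs_of_nonneg (mul_nonneg hft ht0.le), hf.eq_form t ht0]
      calc Real.exp (-lam * t ^ η) * t ^ α * L t * t
          ≤ Real.exp (-lam * t ^ η) * t ^ α * t * t := by
            gcongr; exact (hB t htB.le).1
        _ = t ^ (α + 2) * Real.exp (-lam * t ^ η) := by
            rw [Real.rpow_add ht0, Real.rpow_two]; ring
        _ ≤ t ^ max (α + 2) 0 * Real.exp (-lam * t ^ η) := by
            gcongr
            · linarith
            · exact le_max_left _ _
  refine H.congr ?_
  filter_upwards [ae_restrict_mem measurableSet_Ioi] with v hv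
  rw [ENNReal.toReal_ofReal (h.nonneg_density v hv), smul_eq_mul]

end HasPositiveDensity

/-! ### Measurability and conditioning on the task time. -/

theorem measurable_restartCount {Ω : Type*} [MeasurableSpace Ω] {T : Ω → ℝ} {U : ℕ → Ω → ℝ}
    (hT : Measurable T) (hU : ∀ i, Measurable (U i)) : Measurable (restartCount T U) := by
  have hlt : ∀ n, MeasurableSet {ω | T ω < U n ω} := fun n => measurableSet_lt hT (hU n)
  refine measurable_to_countable' fun n => ?_
  -- The second set accounts for the default value 0 when no failure time exceeds the task time.
  have e : restartCount T U ⁻¹' {n} =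
      ({ω | T ω < U n ω} ∩ ⋂ k ∈ Finset.range n, {ω | T ω < U k ω}ᶜ) ∪
        ({ω | n = 0} ∩ ⋂ k, {ω | T ω < U k ω}ᶜ) := by
    ext ω
    simp only [restartCount, Set.mem_preimage, Set.mem_singleton_iff, Set.mem_union, Set.mem_inter_iff,
      Set.mem_iInter, Set.mem_compl_iff, Set.mem_ofPred_eq, Finset.mem_range]
    constructor
    · rintro rfl
      rcases Set.eq_empty_or_nonempty {n | T ω < U n ω} with hemp | hne
      · right
        exact ⟨by rw [hemp, Nat.sInf_empty], fun k hk => (hemp ▸ hk : k ∈ (∅ : Set ℕ))⟩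
      · left
        exact ⟨Nat.sInf_mem hne, fun k hk => Nat.notMem_of_lt_sInf hk⟩
    · rintro (⟨h1, h2⟩ | ⟨rfl, h2⟩)
      · refine le_antisymm (Nat.sInf_le h1) (not_lt.1 fun hlt => h2 _ hlt ?_)
        exact Nat.sInf_mem (s := {n | T ω < U n ω}) ⟨n, h1⟩
      · rw [Nat.sInf_eq_zero]
        exact Or.inr (Set.eq_empty_iff_forall_notMem.2 h2)
  rw [e]
  refine ((hlt n).inter (Finset.measurableSet_biInter _ fun k _ => (hlt k).compl)).union
    ((MeasurableSet.const _).inter (MeasurableSet.iInter fun k => (hlt k).compl))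

theorem measurable_totalTime {Ω : Type*} [MeasurableSpace Ω] {T : Ω → ℝ} {U : ℕ → Ω → ℝ}
    (hT : Measurable T) (hU : ∀ i, Measurable (U i)) : Measurable (totalTime T U) := by
  have h1 : Measurable fun z : ℕ × Ω => ∑ i ∈ Finset.range z.1, U i z.2 :=
    measurable_from_prod_countable_right fun n =>
      Finset.measurable_sum (Finset.range n) fun i _ => hU i
  exact hT.add (h1.comp ((measurable_restartCount hT hU).prodMk measurable_id))

/-- The tail of the total time for the fixed task time `t`, as a function of the law of the
sequence of failure times. -/
noncomputable def fixedTaskTail (ν : Measure (ℕ → ℝ)) (t x : ℝ) : ℝ :=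
  totalTimeTail ν (fun _ => t) (fun i u => u i) x

theorem measurableSet_lt_totalTime (x : ℝ) : MeasurableSet {z : ℝ × (ℕ → ℝ) |
    x < totalTime (fun z : ℝ × (ℕ → ℝ) => z.1) (fun i z => z.2 i) z} :=
  measurableSet_lt measurable_const (measurable_totalTime measurable_fst fun i => by fun_prop)

theorem measurable_fixedTaskTail (ν : Measure (ℕ → ℝ)) [IsProbabilityMeasure ν] (x : ℝ) :
    Measurable fun t => fixedTaskTail ν t x :=
  (measurable_measure_prodMk_left (ν := ν) (measurableSet_lt_totalTime x)).ennreal_toReal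

namespace IsRestartModel

variable {Ω : Type*} [MeasurableSpace Ω] {P : Measure Ω}
  {T : Ω → ℝ} {U : ℕ → Ω → ℝ} {f g : ℝ → ℝ}

theorem aemeasurable_failures (h : IsRestartModel P T U f g) :
    AEMeasurable (fun ω i => U i ω) P :=
  aemeasurable_pi_lambda _ fun i => (h.failure_density i).hasLaw.aemeasurable

theorem map_map_failures (h : IsRestartModel P T U f g) (i : ℕ) :
    (P.map fun ω i => U i ω).map (fun u : ℕ → ℝ => u i) = P.map (U i) :=
  AEMeasurable.map_map_of_aemeasurable (measurable_pi_apply i).aemeasurable h.aemeasurable_failures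

theorem hasPositiveDensity_eval (h : IsRestartModel P T U f g) (i : ℕ) :
    HasPositiveDensity (P.map fun ω i => U i ω) (fun u : ℕ → ℝ => u i) g where
  measurable_density := (h.failure_density i).measurable_density
  nonneg_density := (h.failure_density i).nonneg_density
  hasLaw := ⟨(measurable_pi_apply i).aemeasurable, by
    rw [h.map_map_failures i, (h.failure_density i).hasLaw.map_eq]⟩

theorem integral_eval (h : IsRestartModel P T U f g) :
    ∫ u, u 0 ∂(P.map fun ω i => U i ω) = ∫ ω, U 0 ω ∂P :=
  integral_map h.aemeasurable_failures (measurable_pi_apply 0).aestronglyMeasurable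

variable [IsProbabilityMeasure P]

theorem isProbabilityMeasure_failures (h : IsRestartModel P T U f g) :
    IsProbabilityMeasure (P.map fun ω i => U i ω) :=
  Measure.isProbabilityMeasure_map h.aemeasurable_failures

/-- The variables `U i` are only a.e. measurable. Replacing them by the coordinates on sequence
space under their joint law gives measurable variables without changing any probability. -/
theorem isFailureSequence (h : IsRestartModel P T U f g) (hint : Integrable (U 0) P) :
    IsFailureSequence (P.map fun ω i => U i ω) (fun i (u : ℕ → ℝ) => u i) where
  measurable i := measurable_pi_apply i
  indep := by
    have := h.isProbabilityMeasure_failures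
    rw [iIndepFun_iff_map_fun_eq_infinitePi_map fun i => measurable_pi_apply i]
    simp_rw [h.map_map_failures]
    rw [← (iIndepFun_iff_map_fun_eq_infinitePi_map₀ h.aemeasurable_failures).1 h.failure_indep]
    exact Measure.map_id
  identDistrib i := ⟨(measurable_pi_apply i).aemeasurable, (measurable_pi_apply 0).aemeasurable, by
    rw [h.map_map_failures, h.map_map_failures, (h.failure_density i).hasLaw.map_eq,
      (h.failure_density 0).hasLaw.map_eq]⟩
  pos := (h.hasPositiveDensity_eval 0).ae_pos
  integrable :=
    (integrable_map_measure (measurable_pi_apply 0).aestronglyMeasurable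
      h.aemeasurable_failures).2 hint

/-- Independence makes the joint law of the task time and the failure sequence a product, and Fubini
integrates out the failures first. -/
theorem totalTimeTail_eq (h : IsRestartModel P T U f g) (x : ℝ) :
    totalTimeTail P T U x =
      ∫ t in Set.Ioi (0 : ℝ), f t * fixedTaskTail (P.map fun ω i => U i ω) t x := by
  have := h.isProbabilityMeasure_failures
  have hT := h.task_density.hasLaw.aemeasurable
  have : IsProbabilityMeasure (P.map T) := Measure.isProbabilityMeasure_map hT
  rw [← h.task_density.integral_comp_eq]
  have hprod := (indepFun_iff_map_prod_eq_prod_map_map hT h.aemeasurable_failures).1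
    h.task_indep_failure
  have e1 : P {ω | x < totalTime T U ω} = (P.map fun ω => (T ω, fun i => U i ω))
      {z : ℝ × (ℕ → ℝ) | x < totalTime (fun z : ℝ × (ℕ → ℝ) => z.1) (fun i z => z.2 i) z} := by
    rw [Measure.map_apply_of_aemeasurable (hT.prodMk h.aemeasurable_failures)
      (measurableSet_lt_totalTime x)]
    rfl
  rw [totalTimeTail, Measure.real, e1, hprod, Measure.prod_apply (measurableSet_lt_totalTime x)]
  rw [← integral_toReal]
  · rfl
  · exact (measurable_measure_prodMk_left (measurableSet_lt_totalTime x)).aemeasurable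
  · exact Eventually.of_forall fun _ => measure_lt_top _ _

end IsRestartModel

/-! ### Laplace-type asymptotics. -/

theorem integrable_exp_neg_mul_abs {b : ℝ} (hb : 0 < b) :
    Integrable fun w : ℝ => Real.exp (-(b * |w|)) := by
  rw [← integrableOn_univ, ← Set.Iic_union_Ioi (a := (0 : ℝ))]
  refine IntegrableOn.union ?_ ?_
  · refine (integrableOn_exp_mul_Iic hb 0).congr_fun (fun w hw => ?_) measurableSet_Iic
    simp only
    rw [abs_of_nonpos hw]; congr 1; ring
  · refine (exp_neg_integrableOn_Ioi 0 hb).congr_fun (fun w hw => ?_) measurableSet_Ioi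
    simp only
    rw [abs_of_pos hw]; congr 1; ring

/-- A Gumbel-type form of the Gamma integral. -/
theorem integral_exp_mul_exp_neg_exp {a b μ : ℝ} (ha : 0 < a) (hb : 0 < b) (hμ : 0 < μ) :
    ∫ w : ℝ, Real.exp (-a * w) * Real.exp (-(μ * Real.exp (-b * w))) =
      (1 / μ) ^ (a / b) * Real.Gamma (a / b) / b := by
  rw [← Real.integral_rpow_mul_exp_neg_mul_Ioi (div_pos ha hb) hμ]
  -- Substitution v = exp(-b w), which maps the line onto the positive half-line.
  have himg : (fun w : ℝ => Real.exp (-b * w)) '' Set.univ = Set.Ioi 0 := by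
    ext v
    simp only [Set.image_univ, Set.mem_range, Set.mem_Ioi]
    constructor
    · rintro ⟨w, rfl⟩; exact Real.exp_pos _
    · intro hv
      refine ⟨-(Real.log v / b), ?_⟩
      rw [show -b * -(Real.log v / b) = Real.log v by field_simp, Real.exp_log hv]
  rw [← himg, integral_image_eq_integral_abs_deriv_smul (f' := fun w => Real.exp (-b * w) * -b)
    MeasurableSet.univ, setIntegral_univ, ← integral_div]
  · congr 1
    ext w
    have h1 : |Real.exp (-b * w) * -b| = b * Real.exp (-b * w) := by
      rw [abs_mul, abs_neg, abs_of_pos hb, Real.abs_exp]; ring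
    rw [h1, smul_eq_mul, ← Real.exp_mul]
    have h2 : Real.exp (-a * w) = Real.exp (-b * w) * Real.exp (-b * w * (a / b - 1)) := by
      rw [← Real.exp_add]; congr 1; field_simp; ring
    rw [h2]; field_simp
  · intro w _
    have h1 : HasDerivAt (fun w : ℝ => -b * w) (-b) w := by
      simpa using (hasDerivAt_id w).const_mul (-b)
    exact h1.exp.hasDerivWithinAt
  · intro w _ w' _ hww
    have := Real.exp_injective hww
    exact mul_left_cancel₀ (neg_ne_zero.2 hb.ne') this

namespace IsExpRegular

variable {lF lG : ℝ} {ψF ψG φF φG : ℝ → ℝ} {a : ℝ → ℝ}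

/-- The normalizer decays at most polynomially in x. Indeed lG / (2x) ≤ φG(a) ≤ exp(-lG a / 2),
while φF(a) ≥ exp(-2 lF a); comparing the exponents gives 4 lF / lG. -/
theorem eventually_lt_rpow_mul (hF : IsExpRegular lF ψF φF) (hG : IsExpRegular lG ψG φG)
    (ha : Tendsto a atTop atTop) (haG : Tendsto (fun x => x * φG (a x)) atTop (𝓝 lG)) :
    ∀ᶠ x in atTop, (lG / 2 / x) ^ (4 * lF / lG) ≤ φF (a x) := by
  have hlF := hF.rate_pos
  have hlG := hG.rate_pos
  filter_upwards [ha.eventually hF.eventually_eq, ha.eventually hG.eventually_eq,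
    ha.eventually (hF.oscillating.isLittleO.bound hlF),
    ha.eventually (hG.oscillating.isLittleO.bound (half_pos hlG)), ha.eventually_ge_atTop 0,
    haG.eventually (le_mem_nhds (half_lt_self hlG)), eventually_gt_atTop 0]
    with x h1 h2 h3 h4 h5 h6 h7
  rw [Real.norm_eq_abs, Real.norm_eq_abs, abs_of_nonneg h5] at h3 h4
  have h8 : lG / 2 / x ≤ Real.exp (-(lG / 2) * a x) := by
    have : lG / 2 / x ≤ φG (a x) := by rw [div_le_iff₀ h7]; linarith
    refine this.trans ?_
    rw [h2]
    apply Real.exp_le_exp.2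
    linarith [(abs_le.1 h4).2]
  calc (lG / 2 / x) ^ (4 * lF / lG) ≤ Real.exp (-(lG / 2) * a x) ^ (4 * lF / lG) :=
        Real.rpow_le_rpow (by positivity) h8 (by positivity)
    _ = Real.exp (-(2 * lF) * a x) := by
        rw [← Real.exp_mul]; congr 1; field_simp; ring
    _ ≤ φF (a x) := by
        rw [h1]
        apply Real.exp_le_exp.2
        linarith [(abs_le.1 h3).1]

variable {R : ℝ → ℝ → ℝ} {μ : ℝ}

/-- Bounded s, where nothing is known about the shape of `φF`, do not matter: `R` decays there
faster than any power of x, so taking one power more than the normalizer leaves O(1/x). -/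
theorem tendsto_integral_div_small (hF : IsExpRegular lF ψF φF) (hG : IsExpRegular lG ψG φG)
    (ha : Tendsto a atTop atTop) (haG : Tendsto (fun x => x * φG (a x)) atTop (𝓝 lG))
    (hφ0 : ∀ s, 0 < s → 0 ≤ φF s) (hφi : IntegrableOn φF (Set.Ioi 0))
    (hG0 : ∀ s, 0 < s → 0 ≤ φG s) (hGi : IntegrableOn φG (Set.Ioi 0))
    (hR0 : ∀ x s, 0 ≤ R x s)
    (hRb : ∀ k : ℝ, 0 < k → ∃ C : ℝ, 0 < C ∧ ∀ x, 0 < x → ∀ s, 0 < s →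
      0 < ∫ v in Set.Ioi s, φG v → R x s ≤ C * (x * ∫ v in Set.Ioi s, φG v) ^ (-k))
    {A : ℝ} (htA : 0 < ∫ v in Set.Ioi A, φG v) :
    Tendsto (fun x => (∫ s in Set.Ioc 0 A, φF s * R x s) / φF (a x)) atTop (𝓝 0) := by
  have hlF := hF.rate_pos
  have hlG := hG.rate_pos
  set q := 4 * lF / lG
  have hq : 0 < q := by positivity
  obtain ⟨C, hC, hRC⟩ := hRb (q + 1) (by linarith)
  set τ := ∫ v in Set.Ioi A, φG v
  set M := C * τ ^ (-(q + 1)) * ∫ s in Set.Ioc 0 A, φF s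
  have hφA : IntegrableOn φF (Set.Ioc 0 A) := hφi.mono_set Set.Ioc_subset_Ioi_self
  have hM : 0 ≤ ∫ s in Set.Ioc 0 A, φF s :=
    setIntegral_nonneg measurableSet_Ioc fun s hs => hφ0 s hs.1
  have hlim : Tendsto (fun x : ℝ => M * (lG / 2) ^ (-q) * x⁻¹) atTop (𝓝 0) := by
    simpa using tendsto_inv_atTop_zero.const_mul (M * (lG / 2) ^ (-q))
  have hnum0 : ∀ x, 0 ≤ ∫ s in Set.Ioc 0 A, φF s * R x s := fun x =>
    setIntegral_nonneg measurableSet_Ioc fun s hs => mul_nonneg (hφ0 s hs.1) (hR0 x s)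
  refine squeeze_zero' ?_ ?_ hlim
  · filter_upwards [ha.eventually hF.eventually_pos] with x hx using div_nonneg (hnum0 x) hx.le
  · filter_upwards [hF.eventually_lt_rpow_mul hG ha haG, ha.eventually hF.eventually_pos,
      eventually_gt_atTop 0] with x h1 h2 hx
    have hnum : ∫ s in Set.Ioc 0 A, φF s * R x s ≤ M * x ^ (-(q + 1)) := by
      have hb : ∀ s ∈ Set.Ioc 0 A, φF s * R x s ≤ φF s * (C * (x * τ) ^ (-(q + 1))) := by
        intro s hs
        refine mul_le_mul_of_nonneg_left ?_ (hφ0 s hs.1)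
        have hts : τ ≤ ∫ v in Set.Ioi s, φG v := by
          refine setIntegral_mono_set (hGi.mono_set (Set.Ioi_subset_Ioi hs.1.le)) ?_
            (Set.Ioi_subset_Ioi hs.2).eventuallyLE
          filter_upwards [ae_restrict_mem measurableSet_Ioi] with v hv
          exact hG0 v (hs.1.trans hv)
        refine (hRC x hx s hs.1 (htA.trans_le hts)).trans ?_
        refine mul_le_mul_of_nonneg_left ?_ hC.le
        exact Real.rpow_le_rpow_of_nonpos (mul_pos hx htA)
          (mul_le_mul_of_nonneg_left hts hx.le) (by linarith)
      calc _ ≤ ∫ s in Set.Ioc 0 A, φF s * (C * (x * τ) ^ (-(q + 1))) := by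
            refine integral_mono_of_nonneg ?_ (hφA.mul_const _) ?_
            · filter_upwards [ae_restrict_mem measurableSet_Ioc] with s hs
              exact mul_nonneg (hφ0 s hs.1) (hR0 x s)
            · filter_upwards [ae_restrict_mem measurableSet_Ioc] with s hs using hb s hs
        _ = M * x ^ (-(q + 1)) := by
            rw [integral_mul_const, Real.mul_rpow hx.le htA.le]; ring
    have hM0 : 0 ≤ M := mul_nonneg (by positivity) hM
    rw [div_le_iff₀ h2]
    calc _ ≤ _ := hnum
      _ = M * (lG / 2) ^ (-q) * x⁻¹ * (lG / 2 / x) ^ q := by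
          rw [Real.div_rpow (by positivity) hx.le, Real.rpow_neg (by positivity : 0 ≤ lG / 2),
            Real.rpow_neg hx.le, Real.rpow_add hx, Real.rpow_one]
          have : (lG / 2) ^ q ≠ 0 := by positivity
          have : x ^ q ≠ 0 := by positivity
          field_simp
      _ ≤ _ := by
          refine mul_le_mul_of_nonneg_left h1 ?_
          have : 0 ≤ (lG / 2) ^ (-q) := by positivity
          have : 0 ≤ x⁻¹ := by positivity
          positivity

/-- The majorant for dominated convergence. For w ≥ 0 the decay of `φF` suffices; for w < 0 the
growth of `φF` must be beaten by the decay of `R`. -/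
theorem exists_le_exp_neg_mul_abs (hF : IsExpRegular lF ψF φF) (hG : IsExpRegular lG ψG φG)
    (ha : Tendsto a atTop atTop) (haG : Tendsto (fun x => x * φG (a x)) atTop (𝓝 lG))
    (hR0 : ∀ x s, 0 ≤ R x s) (hR1 : ∀ x s, R x s ≤ 1)
    (hRb : ∀ k : ℝ, 0 < k → ∃ C : ℝ, 0 < C ∧ ∀ x, 0 < x → ∀ s, 0 < s →
      0 < ∫ v in Set.Ioi s, φG v → R x s ≤ C * (x * ∫ v in Set.Ioi s, φG v) ^ (-k)) :
    ∃ A D ε : ℝ, 0 < A ∧ 0 < ε ∧ 0 ≤ D ∧ 0 < ∫ v in Set.Ioi A, φG v ∧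
      ∀ᶠ x in atTop, ∀ w, A < a x + w → 0 ≤ φF (a x + w) / φF (a x) * R x (a x + w) ∧
        φF (a x + w) / φF (a x) * R x (a x + w) ≤ D * Real.exp (-(ε * |w|)) := by
  have hlF := hF.rate_pos
  have hlG := hG.rate_pos
  set ε := min lF lG / 2 with hεdef
  have hε : 0 < ε := by positivity
  have hεF : 2 * ε ≤ lF := by rw [hεdef]; linarith [min_le_left lF lG]
  have hεG : 2 * ε ≤ lG := by rw [hεdef]; linarith [min_le_right lF lG]
  obtain ⟨A₁, hA₁⟩ := hF.potter hε
  obtain ⟨A₂, hA₂⟩ := hG.potter hε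
  have htail : ∀ᶠ s in atTop, φG s / (2 * lG) ≤ ∫ v in Set.Ioi s, φG v := by
    have hlt : 1 / (2 * lG) < 1 / lG := by
      apply one_div_lt_one_div_of_lt hlG; linarith
    filter_upwards [hG.tendsto_tail.eventually (le_mem_nhds hlt), hG.eventually_pos] with s h1 h2
    rw [le_div_iff₀ h2] at h1
    refine le_trans (le_of_eq ?_) h1
    ring
  obtain ⟨A₃, hA₃⟩ := eventually_atTop.1 htail
  -- For w < 0 the ratio of `φF` grows at most at rate lF + ε in |w|, and x times the tail at least
  -- at rate lG - ε. This power makes `R` decay at rate lF + 2ε, a net gain of ε.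
  set k := (lF + 2 * ε) / (lG - ε) with hk
  have hlGε : 0 < lG - ε := by linarith
  have hk0 : 0 < k := by positivity
  obtain ⟨C, hC, hRC⟩ := hRb k hk0
  set A := max (max A₁ A₂) (max A₃ 1)
  have hAA₁ : A₁ ≤ A := (le_max_left _ _).trans (le_max_left _ _)
  have hAA₂ : A₂ ≤ A := (le_max_right _ _).trans (le_max_left _ _)
  have hAA₃ : A₃ ≤ A := (le_max_left _ _).trans (le_max_right _ _)
  have hA1 : 1 ≤ A := (le_max_right _ _).trans (le_max_right _ _)
  have htpos : ∀ s, A ≤ s → 0 < ∫ v in Set.Ioi s, φG v := fun s hs =>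
    (div_pos (hA₂ s s (hAA₂.trans hs) (hAA₂.trans hs)).1 (by positivity)).trans_le
      (hA₃ s (hAA₃.trans hs))
  -- Product of the Potter constant exp(-ε), the lower bound lG / 2 for x φG(a), and the factor 1 /
  -- (2 lG) from the tail estimate.
  set c := Real.exp (-ε) / 4
  have hc : 0 < c := by positivity
  refine ⟨A, Real.exp ε * (1 + C * c ^ (-k)), ε, by linarith, hε, by positivity,
    htpos A le_rfl, ?_⟩
  filter_upwards [ha.eventually_ge_atTop A, haG.eventually (le_mem_nhds (half_lt_self hlG)),
    eventually_gt_atTop 0] with x hax hx2 hx w hw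
  obtain ⟨p1, p2⟩ := hA₁ (a x) (a x + w) (hAA₁.trans hax) (hAA₁.trans hw.le)
  have p3 := (hA₁ (a x + w) (a x) (hAA₁.trans hw.le) (hAA₁.trans hax)).1
  refine ⟨mul_nonneg (div_nonneg p3.le p1.le) (hR0 _ _), ?_⟩
  have hratio : φF (a x + w) / φF (a x) ≤ Real.exp ε * Real.exp (-lF * w + ε * |w|) := by
    rw [div_le_iff₀ p1]
    rwa [add_sub_cancel_left] at p2
  have hB0 : 0 ≤ Real.exp ε * Real.exp (-lF * w + ε * |w|) := by positivity
  rcases le_or_gt 0 w with hw0 | hw0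
  · calc _ ≤ Real.exp ε * Real.exp (-lF * w + ε * |w|) * 1 :=
          mul_le_mul hratio (hR1 _ _) (hR0 _ _) hB0
      _ ≤ Real.exp ε * Real.exp (-(ε * |w|)) * (1 + C * c ^ (-k)) := by
          refine mul_le_mul ?_ ?_ zero_le_one (by positivity)
          · refine mul_le_mul_of_nonneg_left (Real.exp_le_exp.2 ?_) (Real.exp_pos _).le
            rw [abs_of_nonneg hw0]
            nlinarith
          · have : 0 ≤ C * c ^ (-k) := by positivity
            linarith
      _ = _ := by ring
  · obtain ⟨g1, g2⟩ := hA₂ (a x + w) (a x) (hAA₂.trans hw.le) (hAA₂.trans hax)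
    rw [show a x - (a x + w) = -w by ring, abs_neg] at g2
    have hlow : c * Real.exp (-(lG - ε) * w) ≤ x * ∫ v in Set.Ioi (a x + w), φG v := by
      have t1 := hA₃ (a x + w) (hAA₃.trans hw.le)
      have t2 : lG / 2 ≤ x * (Real.exp ε * Real.exp ((lG - ε) * w) * φG (a x + w)) := by
        refine hx2.trans (mul_le_mul_of_nonneg_left (g2.trans (le_of_eq ?_)) hx.le)
        rw [abs_of_neg hw0]
        congr 3; ring
      have t3 : Real.exp (-ε) * Real.exp ε = 1 := by rw [← Real.exp_add]; simp
      have t4 : Real.exp (-(lG - ε) * w) * Real.exp ((lG - ε) * w) = 1 := by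
        rw [← Real.exp_add, neg_mul, neg_add_cancel, Real.exp_zero]
      calc c * Real.exp (-(lG - ε) * w)
          = Real.exp (-ε) * Real.exp (-(lG - ε) * w) * (lG / 2) / (2 * lG) := by
            simp only [c]; field_simp; ring
        _ ≤ Real.exp (-ε) * Real.exp (-(lG - ε) * w) *
            (x * (Real.exp ε * Real.exp ((lG - ε) * w) * φG (a x + w))) / (2 * lG) := by
            gcongr
        _ = (Real.exp (-ε) * Real.exp ε) * (Real.exp (-(lG - ε) * w) * Real.exp ((lG - ε) * w)) *
            (x * (φG (a x + w) / (2 * lG))) := by ring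
        _ ≤ _ := by
            rw [t3, t4, one_mul, one_mul]
            exact mul_le_mul_of_nonneg_left t1 hx.le
    have hRw : R x (a x + w) ≤ C * c ^ (-k) * Real.exp ((lF + 2 * ε) * w) := by
      refine (hRC x hx (a x + w) (by linarith) (htpos _ hw.le)).trans ?_
      rw [mul_assoc]
      refine mul_le_mul_of_nonneg_left ?_ hC.le
      refine (Real.rpow_le_rpow_of_nonpos (by positivity) hlow (by linarith)).trans (le_of_eq ?_)
      rw [Real.mul_rpow hc.le (Real.exp_pos _).le, ← Real.exp_mul]
      congr 2
      rw [hk]; field_simp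
    calc _ ≤ Real.exp ε * Real.exp (-lF * w + ε * |w|) *
          (C * c ^ (-k) * Real.exp ((lF + 2 * ε) * w)) := mul_le_mul hratio hRw (hR0 _ _) hB0
      _ = Real.exp ε * (C * c ^ (-k)) *
          (Real.exp (-lF * w + ε * |w|) * Real.exp ((lF + 2 * ε) * w)) := by ring
      _ = Real.exp ε * (C * c ^ (-k)) * Real.exp (-(ε * |w|)) := by
          rw [← Real.exp_add, abs_of_neg hw0]
          congr 2; ring
      _ ≤ _ := by
          refine mul_le_mul_of_nonneg_right ?_ (Real.exp_pos _).le
          refine mul_le_mul_of_nonneg_left ?_ (Real.exp_pos _).le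
          linarith

/-- Laplace-type asymptotics of a mixture against an exponentially regular density. -/
theorem tendsto_integral_div (hF : IsExpRegular lF ψF φF) (hG : IsExpRegular lG ψG φG)
    (ha : Tendsto a atTop atTop) (haG : Tendsto (fun x => x * φG (a x)) atTop (𝓝 lG))
    (hφ0 : ∀ s, 0 < s → 0 ≤ φF s) (hφi : IntegrableOn φF (Set.Ioi 0))
    (hG0 : ∀ s, 0 < s → 0 ≤ φG s) (hGi : IntegrableOn φG (Set.Ioi 0))
    (hRm : ∀ x, Measurable (R x)) (hR0 : ∀ x s, 0 ≤ R x s) (hR1 : ∀ x s, R x s ≤ 1)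
    (hRb : ∀ k : ℝ, 0 < k → ∃ C : ℝ, 0 < C ∧ ∀ x, 0 < x → ∀ s, 0 < s →
      0 < ∫ v in Set.Ioi s, φG v → R x s ≤ C * (x * ∫ v in Set.Ioi s, φG v) ^ (-k))
    (hRlim : ∀ w, Tendsto (fun x => R x (a x + w)) atTop
      (𝓝 (Real.exp (-(μ * Real.exp (-lG * w)))))) :
    Tendsto (fun x => (∫ s in Set.Ioi 0, φF s * R x s) / φF (a x)) atTop
      (𝓝 (∫ w, Real.exp (-lF * w) * Real.exp (-(μ * Real.exp (-lG * w))))) := by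
  obtain ⟨A, D, ε, hA, hε, hD, htA, hdom⟩ := hF.exists_le_exp_neg_mul_abs hG ha haG hR0 hR1 hRb
  have hsmall := hF.tendsto_integral_div_small hG ha haG hφ0 hφi hG0 hGi hR0 hRb htA
  have hbig : Tendsto (fun x => ∫ w, (Set.Ioi A).indicator
      (fun s => φF s / φF (a x) * R x s) (a x + w)) atTop
      (𝓝 (∫ w, Real.exp (-lF * w) * Real.exp (-(μ * Real.exp (-lG * w))))) := by
    refine tendsto_integral_filter_of_dominated_convergence
      (fun w => D * Real.exp (-(ε * |w|))) ?_ ?_ ((integrable_exp_neg_mul_abs hε).const_mul D) ?_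
    · refine Eventually.of_forall fun x => ?_
      exact ((((hF.measurable.div_const _).mul (hRm x)).indicator measurableSet_Ioi).comp
        (measurable_const_add (a x))).aestronglyMeasurable
    · filter_upwards [hdom] with x hx
      refine Eventually.of_forall fun w => ?_
      by_cases hw : A < a x + w
      · obtain ⟨h1, h2⟩ := hx w hw
        rw [Set.indicator_of_mem (show a x + w ∈ Set.Ioi A from hw), Real.norm_eq_abs,
          abs_of_nonneg h1]
        exact h2
      · rw [Set.indicator_of_notMem (show a x + w ∉ Set.Ioi A from hw), norm_zero]
        positivity
    · refine Eventually.of_forall fun w => ?_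
      refine ((hF.tendsto_ratio ha w).mul (hRlim w)).congr' ?_
      filter_upwards [(tendsto_atTop_add_const_right _ w ha).eventually_gt_atTop A] with x hx
      rw [Set.indicator_of_mem (show a x + w ∈ Set.Ioi A from hx)]
  have hsum := hsmall.add hbig
  rw [zero_add] at hsum
  refine hsum.congr fun x => ?_
  have hint : IntegrableOn (fun s => φF s * R x s) (Set.Ioi 0) := by
    refine Integrable.mono' hφi (hF.measurable.mul (hRm x)).aestronglyMeasurable ?_
    filter_upwards [ae_restrict_mem measurableSet_Ioi] with s hs
    rw [Real.norm_eq_abs, abs_of_nonneg (mul_nonneg (hφ0 s hs) (hR0 x s))]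
    exact mul_le_of_le_one_right (hφ0 s hs) (hR1 x s)
  rw [integral_add_left_eq_self ((Set.Ioi A).indicator fun s => φF s / φF (a x) * R x s) (a x),
    integral_indicator measurableSet_Ioi, ← Set.Ioc_union_Ioi_eq_Ioi hA.le,
    setIntegral_union (Set.Ioc_disjoint_Ioi le_rfl) measurableSet_Ioi
      (hint.mono_set Set.Ioc_subset_Ioi_self) (hint.mono_set (Set.Ioi_subset_Ioi hA.le)),
    add_div, ← integral_div (φF (a x)) fun s => φF s * R x s]
  congr 2
  rw [← integral_div]
  congr 1
  ext s; ring

end IsExpRegular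

/-- Raise z' ≤ exp z' with z' = c z / k to the power k. This turns the exponential bound on the
total time into polynomial bounds of every order. -/
theorem exp_neg_mul_le_rpow {c k z : ℝ} (hc : 0 < c) (hk : 0 < k) (hz : 0 < z) :
    Real.exp (-(c * z)) ≤ (k / c) ^ k * z ^ (-k) := by
  have h1 : c * z / k ≤ Real.exp (c * z / k) := by
    linarith [Real.add_one_le_exp (c * z / k)]
  have h2 := Real.rpow_le_rpow (by positivity) h1 hk.le
  rw [← Real.exp_mul, div_mul_cancel₀ _ hk.ne',
    show c * z / k = (k / c)⁻¹ * z by field_simp, Real.mul_rpow (by positivity) hz.le,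
    Real.inv_rpow (by positivity)] at h2
  have h3 : 0 < (k / c) ^ k := by positivity
  have h4 : 0 < z ^ k := by positivity
  rw [Real.exp_neg, Real.rpow_neg hz.le, ← div_eq_mul_inv, inv_le_comm₀ (Real.exp_pos _) (by positivity),
    inv_div]
  refine le_trans (le_of_eq ?_) h2
  ring

theorem integrableOn_powDensity {η : ℝ} (hη : 0 < η) {f : ℝ → ℝ}
    (hf : IntegrableOn f (Set.Ioi 0)) : IntegrableOn (powDensity η f) (Set.Ioi 0) := by
  refine ((integrableOn_Ioi_comp_rpow_iff f (p := 1 / η) (by positivity)).2 hf).congr_fun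
    (fun s _ => ?_) measurableSet_Ioi
  simp only
  rw [abs_of_pos (by positivity), smul_eq_mul, powDensity]

/-! ### The critical scale. -/

/-- The location, on the scale of `η`-th powers, of the task times that dominate the event that
the total time exceeds `x`. -/
noncomputable def criticalScale (lam : ℝ) (ψ : ℝ → ℝ) (x : ℝ) : ℝ :=
  (Real.log x + ψ (Real.log x / lam) - Real.log lam) / lam

theorem tendsto_criticalScale_div_log {lam : ℝ} {ψ : ℝ → ℝ} (hlam : 0 < lam)
    (hψ : IsSlowlyOscillating ψ) :
    Tendsto (fun x => criticalScale lam ψ x / Real.log x) atTop (𝓝 (1 / lam)) := by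
  have hl : Tendsto (fun x => Real.log x / lam) atTop atTop :=
    Real.tendsto_log_atTop.atTop_div_const hlam
  have h1 := (hψ.isLittleO.tendsto_div_nhds_zero.comp hl).mul_const (1 / lam)
  have h2 := (tendsto_inv_atTop_zero.comp Real.tendsto_log_atTop).const_mul (Real.log lam)
  have h3 := ((h1.const_add 1).sub h2).mul_const (1 / lam)
  simp only [zero_mul, mul_zero, add_zero, sub_zero, one_mul] at h3
  refine h3.congr' ?_
  filter_upwards [Real.tendsto_log_atTop.eventually_gt_atTop 0] with x hx
  simp only [Function.comp, criticalScale]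
  field_simp

theorem tendsto_criticalScale {lam : ℝ} {ψ : ℝ → ℝ} (hlam : 0 < lam)
    (hψ : IsSlowlyOscillating ψ) : Tendsto (criticalScale lam ψ) atTop atTop := by
  refine (Real.tendsto_log_atTop.atTop_mul_pos (one_div_pos.2 hlam)
    (tendsto_criticalScale_div_log hlam hψ)).congr' ?_
  filter_upwards [Real.tendsto_log_atTop.eventually_gt_atTop 0] with x hx
  field_simp

/-- The exact equation is lam s = log x + ψ(s) - log lam. One iteration from log x / lam suffices,
because it changes s by a factor tending to 1, to which ψ is asymptotically blind. -/
theorem IsWeibullTypeDensity.tendsto_mul_powDensity_criticalScale {lam η α : ℝ} {L g : ℝ → ℝ}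
    (hη : 0 < η) (hlam : 0 < lam) (hg : IsWeibullTypeDensity lam η α L g) (hm : Measurable g) :
    Tendsto (fun x => x * powDensity η g (criticalScale lam (logDensityPart η α L) x)) atTop
      (𝓝 lam) := by
  have hreg := hg.isExpRegular hη hlam hm
  set ψ := logDensityPart η α L
  have ha := tendsto_criticalScale hlam hreg.oscillating
  have hl : Tendsto (fun x => Real.log x / lam) atTop atTop :=
    Real.tendsto_log_atTop.atTop_div_const hlam
  have hr : Tendsto (fun x => criticalScale lam ψ x / (Real.log x / lam)) atTop (𝓝 1) := by
    have := (tendsto_criticalScale_div_log hlam hreg.oscillating).mul_const lam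
    rw [one_div_mul_cancel hlam.ne'] at this
    refine this.congr fun x => ?_
    rw [div_div_eq_mul_div]; ring
  have h1 := hg.slowlyVarying.tendsto_logDensityPart_sub (α := α) hη one_pos hl hr
  rw [Real.log_one, mul_zero] at h1
  have h2 := (h1.add_const (Real.log lam)).rexp
  rw [zero_add, Real.exp_log hlam] at h2
  refine h2.congr' ?_
  filter_upwards [ha.eventually hreg.eventually_eq, eventually_gt_atTop 0] with x hx hx0
  rw [hx]
  nth_rw 3 [← Real.exp_log hx0]
  rw [← Real.exp_add]
  congr 1
  have : lam * criticalScale lam ψ x = Real.log x + ψ (Real.log x / lam) - Real.log lam := by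
    rw [criticalScale]; field_simp
  linarith

theorem tendsto_add_rpow_div_self {a : ℝ → ℝ} {κ : ℝ} (hκ : 0 < κ)
    (ha : Tendsto (fun x => a x / Real.log x) atTop (𝓝 κ)) (w r : ℝ) :
    Tendsto (fun x => (a x + w) ^ r / x) atTop (𝓝 0) := by
  have h1 := ha.add ((tendsto_inv_atTop_zero.comp Real.tendsto_log_atTop).const_mul w)
  rw [mul_zero, add_zero] at h1
  have h2 := (h1.rpow_const (p := r) (Or.inl hκ.ne')).mul
    (isLittleO_log_rpow_rpow_atTop r (one_pos)).tendsto_div_nhds_zero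
  rw [mul_zero] at h2
  refine h2.congr' ?_
  filter_upwards [Real.tendsto_log_atTop.eventually_gt_atTop 0,
    h1.eventually (lt_mem_nhds hκ)] with x hx h3
  simp only [Function.comp] at h3 ⊢
  rw [Real.rpow_one, mul_div_assoc', ← Real.mul_rpow h3.le hx.le]
  congr 2
  field_simp

/-! ### Tail asymptotics for the restart model. -/

namespace IsRestartModel

variable {Ω : Type*} [MeasurableSpace Ω] {P : Measure Ω}
  {T : Ω → ℝ} {U : ℕ → Ω → ℝ} {f g LF LG : ℝ → ℝ} {η lamF lamG αF αG : ℝ}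

theorem measureReal_rpow_lt_eval (h : IsRestartModel P T U f g) (hη : 0 < η) {s : ℝ}
    (hs : 0 ≤ s) : (P.map fun ω i => U i ω).real {u | s ^ (1 / η) < u 0} =
      ∫ v in Set.Ioi s, powDensity η g v := by
  rw [setIntegral_Ioi_powDensity hη g hs,
    ← (h.hasPositiveDensity_eval 0).measureReal_gt (by positivity)]

variable [IsProbabilityMeasure P]

theorem integrable_failure (h : IsRestartModel P T U f g) (hη : 0 < η) (hlamG : 0 < lamG)
    (hg : IsWeibullTypeDensity lamG η αG LG g) : Integrable (U 0) P :=
  (h.failure_density 0).integrable_of_isWeibullTypeDensity hη hlamG hg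

/-- The tail of the total time, relative to the density of the `η`-th power of the task time. -/
theorem tendsto_totalTimeTail_div (h : IsRestartModel P T U f g) (hη : 0 < η) (hlamF : 0 < lamF)
    (hlamG : 0 < lamG) (hf : IsWeibullTypeDensity lamF η αF LF f)
    (hg : IsWeibullTypeDensity lamG η αG LG g) :
    Tendsto (fun x => totalTimeTail P T U x /
        powDensity η f (criticalScale lamG (logDensityPart η αG LG) x)) atTop
      (𝓝 ((∫ ω, U 0 ω ∂P) ^ (lamF / lamG) * Real.Gamma (lamF / lamG) / lamG)) := by
  have hν := h.isFailureSequence (h.integrable_failure hη hlamG hg)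
  have hνp := h.isProbabilityMeasure_failures
  have hfm := h.task_density.measurable_density
  have hgm := (h.failure_density 0).measurable_density
  have hF := hf.isExpRegular hη hlamF hfm
  have hG := hg.isExpRegular hη hlamG hgm
  have hpow0 : ∀ q : ℝ → ℝ, (∀ t, 0 < t → 0 ≤ q t) → ∀ s, 0 < s → 0 ≤ powDensity η q s := by
    intro q hq s hs
    have := hq (s ^ (1 / η)) (by positivity)
    unfold powDensity
    positivity
  have hm : 0 < ∫ ω, U 0 ω ∂P := h.integral_eval ▸ hν.mean_pos
  set m := ∫ ω, U 0 ω ∂P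
  set ν := P.map fun ω i => U i ω
  set a := criticalScale lamG (logDensityPart η αG LG)
  have ha : Tendsto a atTop atTop := tendsto_criticalScale hlamG hG.oscillating
  have haG : Tendsto (fun x => x * powDensity η g (a x)) atTop (𝓝 lamG) :=
    hg.tendsto_mul_powDensity_criticalScale hη hlamG hgm
  have key := hF.tendsto_integral_div hG ha haG (R := fun x s => fixedTaskTail ν (s ^ (1 / η)) x)
    (μ := 1 / m)
    (hpow0 f h.task_density.nonneg_density) (integrableOn_powDensity hη h.task_density.integrableOn)
    (hpow0 g (h.failure_density 0).nonneg_density)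
    (integrableOn_powDensity hη (h.failure_density 0).integrableOn)
    (fun x => (measurable_fixedTaskTail ν x).comp (by fun_prop))
    (fun x s => measureReal_nonneg) (fun x s => measureReal_le_one) ?_ ?_
  · rw [integral_exp_mul_exp_neg_exp hlamF hlamG (one_div_pos.2 hm), one_div_one_div] at key
    refine key.congr fun x => ?_
    rw [h.totalTimeTail_eq, integral_powDensity_mul hη f fun t => fixedTaskTail ν t x]
  · intro k hk
    obtain ⟨C, c, hC, hc, hb⟩ := hν.exists_totalTimeTail_le_exp
    refine ⟨C * (k / c) ^ k, by positivity, fun x hx s hs htail => ?_⟩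
    refine (hb (s ^ (1 / η)) (by positivity) x hx.le).trans ?_
    rw [h.measureReal_rpow_lt_eval hη hs.le, mul_assoc]
    exact mul_le_mul_of_nonneg_left (exp_neg_mul_le_rpow hc hk (by positivity)) hC.le
  · intro w
    have haw : Tendsto (fun x => a x + w) atTop atTop := tendsto_atTop_add_const_right _ w ha
    -- The tail factors as (tail / φ)(a + w) times φ(a + w) / φ(a) times x φ(a), with limits 1 /
    -- lamG, exp(-lamG w) and lamG.
    have htail : Tendsto (fun x => x * ∫ v in Set.Ioi (a x + w), powDensity η g v) atTop
        (𝓝 (Real.exp (-lamG * w))) := by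
      have := ((hG.tendsto_tail.comp haw).mul (hG.tendsto_ratio ha w)).mul haG
      rw [mul_comm (1 / lamG), mul_assoc, one_div_mul_cancel hlamG.ne', mul_one] at this
      refine this.congr' ?_
      filter_upwards [ha.eventually hG.eventually_pos, haw.eventually hG.eventually_pos]
        with x h1 h2
      simp only [Function.comp]
      field_simp
    have hev : ∀ᶠ x in atTop, ν.real {u | (a x + w) ^ (1 / η) < u 0} =
        ∫ v in Set.Ioi (a x + w), powDensity η g v := by
      filter_upwards [haw.eventually_ge_atTop 0] with x hx
      exact h.measureReal_rpow_lt_eval hη hx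
    have lim := hν.tendsto_totalTimeTail (l := atTop) (x := fun x => x)
      (t := fun x => (a x + w) ^ (1 / η)) (y := Real.exp (-lamG * w)) tendsto_id
      (by filter_upwards [haw.eventually_ge_atTop 0] with x hx; positivity)
      (tendsto_add_rpow_div_self (one_div_pos.2 hlamG)
        (tendsto_criticalScale_div_log hlamG hG.oscillating) w _)
      (by
        filter_upwards [hev, htail.eventually (lt_mem_nhds (Real.exp_pos _)),
          eventually_gt_atTop 0] with x h1 h2 h3
        rw [h1]
        exact (pos_iff_pos_of_mul_pos h2).1 h3)
      (htail.congr' (by filter_upwards [hev] with x h1; rw [h1]))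
    rw [h.integral_eval, div_eq_mul_one_div (Real.exp (-lamG * w)), mul_comm _ (1 / _)] at lim
    exact lim

/-- With the explicit critical scale a(x), the linear part of the exponent of φ_F is -α_H (log x +
ψ_G(log x / lamG) - log lamG), which releases the power of x. Moving the arguments of ψ_F and ψ_G to
log x multiplies by powers of lamG only. -/
theorem tendsto_totalTimeTail_mul_rpow_div (h : IsRestartModel P T U f g) (hη : 0 < η)
    (hlamF : 0 < lamF) (hlamG : 0 < lamG) (hf : IsWeibullTypeDensity lamF η αF LF f)
    (hg : IsWeibullTypeDensity lamG η αG LG g) :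
    Tendsto (fun x => totalTimeTail P T U x * x ^ (lamF / lamG) /
        Real.exp (logDensityPart η αF LF (Real.log x) -
          lamF / lamG * logDensityPart η αG LG (Real.log x))) atTop
      (𝓝 ((∫ ω, U 0 ω ∂P) ^ (lamF / lamG) * Real.Gamma (lamF / lamG) *
        lamG ^ (lamF / lamG - 1 - logExponent η αF αG (lamF / lamG)))) := by
  have h1 := h.tendsto_totalTimeTail_div hη hlamF hlamG hf hg
  have hF := hf.isExpRegular hη hlamF h.task_density.measurable_density
  have hψ := hg.slowlyVarying.isSlowlyOscillating_logDensityPart (α := αG) hη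
  set αH := lamF / lamG
  set ψF := logDensityPart η αF LF
  set ψG := logDensityPart η αG LG
  set a := criticalScale lamG ψG with hadef
  have ha : Tendsto a atTop atTop := tendsto_criticalScale hlamG hψ
  have h2 := hf.slowlyVarying.tendsto_logDensityPart_sub (α := αF) hη (one_div_pos.2 hlamG)
    Real.tendsto_log_atTop (tendsto_criticalScale_div_log hlamG hψ)
  have h3 := hg.slowlyVarying.tendsto_logDensityPart_sub (α := αG) hη (one_div_pos.2 hlamG)
    Real.tendsto_log_atTop (b := fun x => Real.log x / lamG) (by
      refine tendsto_const_nhds.congr' ?_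
      filter_upwards [Real.tendsto_log_atTop.eventually_gt_atTop 0] with x hx
      field_simp)
  have h4 := ((h2.sub (h3.const_mul αH)).add_const (αH * Real.log lamG)).rexp
  have h5 := h1.mul h4
  have hlim : (∫ ω, U 0 ω ∂P) ^ αH * Real.Gamma αH / lamG *
      Real.exp (((αF + 1) / η - 1) * Real.log (1 / lamG) -
        αH * (((αG + 1) / η - 1) * Real.log (1 / lamG)) + αH * Real.log lamG) =
      (∫ ω, U 0 ω ∂P) ^ αH * Real.Gamma αH *
        lamG ^ (αH - 1 - logExponent η αF αG αH) := by
    have : Real.exp (((αF + 1) / η - 1) * Real.log (1 / lamG) -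
        αH * (((αG + 1) / η - 1) * Real.log (1 / lamG)) + αH * Real.log lamG) =
        lamG * lamG ^ (αH - 1 - logExponent η αF αG αH) := by
      rw [Real.rpow_def_of_pos hlamG]
      nth_rw 4 [← Real.exp_log hlamG]
      rw [← Real.exp_add, one_div, Real.log_inv, logExponent]
      congr 1
      field_simp
      ring
    rw [this]; field_simp
  rw [hlim] at h5
  refine h5.congr' ?_
  filter_upwards [ha.eventually hF.eventually_eq, eventually_gt_atTop 0] with x hx hx0
  have hpos : 0 < powDensity η f (a x) := by rw [hx]; exact Real.exp_pos _
  have e : Real.exp (ψF (a x) - ψF (Real.log x) - αH * (ψG (Real.log x / lamG) - ψG (Real.log x)) +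
      αH * Real.log lamG) = powDensity η f (a x) * x ^ αH /
        Real.exp (ψF (Real.log x) - αH * ψG (Real.log x)) := by
    rw [hx, Real.rpow_def_of_pos hx0, ← Real.exp_add, ← Real.exp_sub]
    congr 1
    have : lamF * a x = αH * (Real.log x + ψG (Real.log x / lamG) - Real.log lamG) := by
      simp only [hadef, criticalScale, αH]; field_simp
    linarith
  rw [e]
  field_simp

/-- Slow variation is inherited from the comparison function: log(c x) / log x → 1, so both ψ terms
at log x are unaffected in the limit. Local regularity comes from the tail being monotone and at
most 1. -/
theorem isSlowlyVarying_totalTimeTail_mul_rpow (h : IsRestartModel P T U f g) (hη : 0 < η)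
    (hlamF : 0 < lamF) (hlamG : 0 < lamG) (hf : IsWeibullTypeDensity lamF η αF LF f)
    (hg : IsWeibullTypeDensity lamG η αG LG g) :
    IsSlowlyVarying fun x => totalTimeTail P T U x * x ^ (lamF / lamG) := by
  have hlim := h.tendsto_totalTimeTail_mul_rpow_div hη hlamF hlamG hf hg
  have hν := h.isFailureSequence (h.integrable_failure hη hlamG hg)
  have hνp := h.isProbabilityMeasure_failures
  have hm : 0 < ∫ ω, U 0 ω ∂P := h.integral_eval ▸ hν.mean_pos
  have hα : 0 < lamF / lamG := div_pos hlamF hlamG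
  set D := (∫ ω, U 0 ω ∂P) ^ (lamF / lamG) * Real.Gamma (lamF / lamG) *
        lamG ^ (lamF / lamG - 1 - logExponent η αF αG (lamF / lamG))
  have hD : 0 < D := by
    have := Real.Gamma_pos_of_pos hα
    positivity
  have hpos : ∀ᶠ x in atTop, 0 < totalTimeTail P T U x * x ^ (lamF / lamG) := by
    filter_upwards [hlim.eventually (lt_mem_nhds hD)] with x hx
    exact (div_pos_iff_of_pos_right (Real.exp_pos _)).1 hx
  constructor
  · have hanti : Antitone (totalTimeTail P T U) := fun x y hxy =>
      measureReal_mono fun ω hω => lt_of_le_of_lt hxy hω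
    exact (hanti.measurable.mul (measurable_id.pow_const _)).comp measurable_subtype_coe
  · intro K hK hK0
    have hcont : ContinuousOn (fun x : ℝ => x ^ (lamF / lamG)) K := fun x hx =>
      (Real.continuousAt_rpow_const x _ (Or.inl (hK0 hx).ne')).continuousWithinAt
    obtain ⟨B, hB⟩ := hK.exists_bound_of_continuousOn hcont
    refine isBounded_iff_forall_norm_le.2 ⟨B, ?_⟩
    rintro _ ⟨x, hx, rfl⟩
    simp only [norm_mul]
    have h1 : ‖totalTimeTail P T U x‖ ≤ 1 := by
      rw [Real.norm_eq_abs, totalTimeTail, abs_of_nonneg measureReal_nonneg]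
      exact measureReal_le_one
    exact (mul_le_of_le_one_left (norm_nonneg _) h1).trans (hB x hx)
  · exact hpos
  · intro c hc
    have hcx : Tendsto (fun x : ℝ => c * x) atTop atTop := tendsto_id.const_mul_atTop hc
    have hlog : Tendsto (fun x => Real.log (c * x) / Real.log x) atTop (𝓝 1) := by
      have := ((tendsto_inv_atTop_zero.comp Real.tendsto_log_atTop).const_mul (Real.log c)).add_const 1
      rw [mul_zero, zero_add] at this
      refine this.congr' ?_
      filter_upwards [Real.tendsto_log_atTop.eventually_gt_atTop 0, eventually_gt_atTop 0]
        with x hx hx0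
      rw [Real.log_mul hc.ne' hx0.ne']
      simp only [Function.comp]
      field_simp
    have h1 := hf.slowlyVarying.tendsto_logDensityPart_sub (α := αF) hη one_pos
      Real.tendsto_log_atTop hlog
    have h2 := hg.slowlyVarying.tendsto_logDensityPart_sub (α := αG) hη one_pos
      Real.tendsto_log_atTop hlog
    have h3 := (h1.sub (h2.const_mul (lamF / lamG))).rexp
    rw [Real.log_one, mul_zero, mul_zero, mul_zero, sub_zero, Real.exp_zero] at h3
    have h4 := ((hlim.comp hcx).div hlim hD.ne').mul h3
    rw [div_self hD.ne', one_mul] at h4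
    refine h4.congr' ?_
    filter_upwards [hpos] with x hx
    simp only [Function.comp, Pi.div_apply]
    rw [show ∀ p q r s : ℝ, p - q - lamF / lamG * (r - s) =
      (p - lamF / lamG * r) - (q - lamF / lamG * s) from fun p q r s => by ring, Real.exp_sub (_ - _)]
    have e1 := Real.exp_pos (logDensityPart η αF LF (Real.log (c * x)) -
      lamF / lamG * logDensityPart η αG LG (Real.log (c * x)))
    have e2 := Real.exp_pos (logDensityPart η αF LF (Real.log x) -
      lamF / lamG * logDensityPart η αG LG (Real.log x))
    have hx' := hx.ne'
    generalize totalTimeTail P T U x * x ^ (lamF / lamG) = q at *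
    field_simp

end IsRestartModel

/-- Source of the factor η^(α_H - 1): each density on the new scale carries the Jacobian constant 1
/ η, entering once with exponent 1 and once with exponent -α_H. The coefficients of log s combine to
the exponent ω. -/
theorem eventually_exp_logDensityPart_sub {LF LG : ℝ → ℝ} (hLF : IsSlowlyVarying LF)
    (hLG : IsSlowlyVarying LG) {η : ℝ} (hη : 0 < η) (αF αG αH : ℝ) :
    ∀ᶠ s in atTop, Real.exp (logDensityPart η αF LF s - αH * logDensityPart η αG LG s) =
      η ^ (αH - 1) * s ^ logExponent η αF αG αH *
        (LF (s ^ (1 / η)) / LG (s ^ (1 / η)) ^ αH) := by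
  have ht := tendsto_rpow_atTop (y := 1 / η) (by positivity)
  filter_upwards [ht.eventually hLF.eventually_pos, ht.eventually hLG.eventually_pos,
    eventually_gt_atTop 0] with s h1 h2 h3
  have e : Real.exp (Real.log s / η) = s ^ (1 / η) := by
    rw [Real.rpow_def_of_pos h3]; congr 1; ring
  rw [logDensityPart, logDensityPart, e, Real.rpow_def_of_pos hη, Real.rpow_def_of_pos h2,
    Real.rpow_def_of_pos h3 (logExponent _ _ _ _)]
  nth_rw 2 [← Real.exp_log h1]
  rw [← Real.exp_sub, ← Real.exp_add, ← Real.exp_add, logExponent]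
  congr 1
  field_simp
  ring

theorem mainTheorem8 {Ω : Type*} [MeasurableSpace Ω] (P : Measure Ω) [IsProbabilityMeasure P]
    (T : Ω → ℝ) (U : ℕ → Ω → ℝ) (f g LF LG : ℝ → ℝ) (η lamF lamG αF αG αH ω μ : ℝ)
    (hη : 0 < η) (hlamF : 0 < lamF) (hlamG : 0 < lamG)
    (hmodel : IsRestartModel P T U f g)
    (hf : IsWeibullTypeDensity lamF η αF LF f)
    (hg : IsWeibullTypeDensity lamG η αG LG g)
    (hαH : αH = lamF / lamG) (hω : ω = logExponent η αF αG αH) (hμ : μ = 1 / ∫ z, U 0 z ∂P) :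
    Integrable (U 0) P ∧ 0 < ∫ z, U 0 z ∂P ∧
    ∃ LH : ℝ → ℝ, IsSlowlyVarying LH ∧
      (∀ x : ℝ, 0 < x → totalTimeTail P T U x = LH x / x ^ αH) ∧
      LH ~[atTop] fun x : ℝ =>
        Real.Gamma αH * lamG ^ (αH - 1 - ω) * η ^ (αH - 1) / μ ^ αH * Real.log x ^ ω *
          (LF (Real.log x ^ (1 / η)) / LG (Real.log x ^ (1 / η)) ^ αH) := by
  have hint := hmodel.integrable_failure hη hlamG hg
  have hνp := hmodel.isProbabilityMeasure_failures
  have hm : 0 < ∫ z, U 0 z ∂P := hmodel.integral_eval ▸ (hmodel.isFailureSequence hint).mean_pos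
  refine ⟨hint, hm, fun x => totalTimeTail P T U x * x ^ αH, ?_, fun x hx => ?_, ?_⟩
  · rw [hαH]
    exact hmodel.isSlowlyVarying_totalTimeTail_mul_rpow hη hlamF hlamG hf hg
  · have : x ^ αH ≠ 0 := (Real.rpow_pos_of_pos hx _).ne'
    field_simp
  · have hlim := hmodel.tendsto_totalTimeTail_mul_rpow_div hη hlamF hlamG hf hg
    rw [← hαH, ← hω] at hlim
    have hα : 0 < αH := hαH ▸ div_pos hlamF hlamG
    set D := (∫ z, U 0 z ∂P) ^ αH * Real.Gamma αH * lamG ^ (αH - 1 - ω)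
    have hD : D ≠ 0 := by
      have := Real.Gamma_pos_of_pos hα
      positivity
    have hK : (fun x => D * Real.exp (logDensityPart η αF LF (Real.log x) -
          αH * logDensityPart η αG LG (Real.log x))) =ᶠ[atTop] fun x : ℝ =>
        Real.Gamma αH * lamG ^ (αH - 1 - ω) * η ^ (αH - 1) / μ ^ αH * Real.log x ^ ω *
          (LF (Real.log x ^ (1 / η)) / LG (Real.log x ^ (1 / η)) ^ αH) := by
      filter_upwards [Real.tendsto_log_atTop.eventually (eventually_exp_logDensityPart_sub
        hf.slowlyVarying hg.slowlyVarying hη αF αG αH)] with x hx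
      rw [hx, ← hω, hμ, one_div (∫ z, U 0 z ∂P), Real.inv_rpow hm.le, div_inv_eq_mul]
      ring
    refine IsEquivalent.congr_right ?_ hK
    rw [isEquivalent_iff_tendsto_one (Eventually.of_forall fun x =>
      mul_ne_zero hD (Real.exp_pos _).ne')]
    have := hlim.div_const D
    rw [div_self hD] at this
    refine this.congr fun x => ?_
    simp only [Pi.div_apply]
    rw [div_div, mul_comm D]
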